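/- Let $a>0$, $\alpha\in\mathbb R$, and let $H$ be the operator in $L^2(-a,a)$ given by $H\psi=-\psi''$ on $\mathrm{Dom}(H)=\{\psi\in W^{2,2}(-a,a):\ \psi'(\pm a)+i\alpha\,\psi(\pm a)=0\}$ (that is, with boundary constants $c_\pm=i\alpha$). The inner product $\langle\cdot,\cdot\rangle$ is antilinear in the first argument. Put $k_n:=\frac{n\pi}{2a}$ and $$\chi_n^D(x):=\tfrac1{\sqrt a}\sin k_n(x+a)\ \ (n\ge 0),\qquad \chi_0^N(x):=\tfrac1{\sqrt{2a}},\qquad \chi_n^N(x):=\tfrac1{\sqrt a}\cos k_n(x+a)\ \ (n\ge1),$$ $$\phi_0(x):=\tfrac1{\sqrt{2a}}e^{i\alpha(x+a)},\qquad \phi_n(x):=\chi_n^N(x)+i\tfrac{\alpha}{k_n}\chi_n^D(x)\ \ (n\ge1),$$ the $\phi_n$ being eigenfunctions of $H^*$. Let $(C_n)_{n\ge0}$ be real numbers with $0<m_1<C_n<m_2<\infty$ for all $n\ge0$. Then the series $$\Theta:=\sum_{n=0}^\infty C_n^2\,\phi_n\langle\phi_n,\cdot\rangle,\qquad J^\iota:=\sum_{n=0}^\infty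 C_n^2\,\chi_n^\iota\langle\chi_n^\iota,\cdot\rangle\quad(\iota\in\{D,N\})$$ converge strongly to bounded operators on $L^2(-a,a)$, and $$\Theta=J^N+C_0^2\,\theta_1+J^N\theta_2+J^D\theta_3,$$ where $\theta_1,\theta_2,\theta_3$ are the bounded integral operators on $L^2(-a,a)$ with kernels $$\theta_1(x,y)=\tfrac{i}{a}\,e^{\frac{i\alpha}{2}(x-y)}\sin\!\big(\tfrac{\alpha}{2}(x-y)\big),\qquad \theta_2(x,y)=\tfrac{i\alpha}{2a}\big[y-a\,\mathrm{sgn}(y-x)\big],$$ $$\theta_3(x,y)=\tfrac{\alpha^2}{2a}(a^2-xy)-\tfrac{i\alpha}{2a}x-\tfrac{i\alpha}{2}\big[1-i\alpha(y-x)\big]\mathrm{sgn}(y-x).$$ Moreover, $\Theta$ is a metric operator for $H$ — i.e. $\Theta$ is bounded, satisfies $\langle f,\Theta f\rangle>0$ for all $f\neq0$, has a bounded inverse, and $H=\Theta^{-1}H^*\Theta$ (with equality of domains) — if and only if $|\alpha|\neq k_n$ for every integer $n\ge1$. -/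

import Mathlib

open MeasureTheory Set Filter Topology
open scoped ComplexOrder

noncomputable section

namespace PTRobin

/-- Lebesgue measure on the interval `(-a, a)`. -/
abbrev mu (a : ℝ) : Measure ℝ := volume.restrict (Ioo (-a) a)

/-- The complex Hilbert space `L²(-a, a)`; Mathlib's inner product `inner ℂ f g = ∫ conj f * g`
is antilinear in the first slot. -/
abbrev L2 (a : ℝ) : Type := Lp ℂ 2 (mu a)

/-! ### The operator `H` -/

/-- `u` is absolutely continuous on `[-a, a]` and `v` is its (a.e.) derivative. -/
def IsPrimitive (a : ℝ) (u v : ℝ → ℂ) : Prop :=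
  Integrable v (mu a) ∧ ∀ x ∈ Icc (-a) a, u x = u (-a) + ∫ t in (-a)..x, v t

theorem IsPrimitive.zero (a : ℝ) : IsPrimitive a (fun _ => 0) (fun _ => 0) := by
  refine ⟨by simp, fun x _ => by simp⟩

theorem intervalIntegrable_of_integrable {a : ℝ} {v : ℝ → ℂ}
    (h : Integrable v (mu a)) (ha : -a ≤ a) : IntervalIntegrable v volume (-a) a := by
  rw [intervalIntegrable_iff_integrableOn_Ioo_of_le ha]
  exact h

theorem intervalIntegrable_left {a x : ℝ} {v : ℝ → ℂ}
    (h : Integrable v (mu a)) (hx : x ∈ Icc (-a) a) :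
    IntervalIntegrable v volume (-a) x := by
  refine (intervalIntegrable_of_integrable h (hx.1.trans hx.2)).mono_set ?_
  rw [uIcc_of_le hx.1, uIcc_of_le (hx.1.trans hx.2)]
  exact Icc_subset_Icc_right hx.2

theorem IsPrimitive.add {a : ℝ} {u v u' v' : ℝ → ℂ} (h : IsPrimitive a u v)
    (h' : IsPrimitive a u' v') :
    IsPrimitive a (fun x => u x + u' x) (fun x => v x + v' x) := by
  refine ⟨h.1.add h'.1, fun x hx => ?_⟩
  rw [intervalIntegral.integral_add (intervalIntegrable_left h.1 hx)
    (intervalIntegrable_left h'.1 hx)]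
  simp only [h.2 x hx, h'.2 x hx]
  ring

theorem IsPrimitive.smul {a : ℝ} {u v : ℝ → ℂ} (c : ℂ) (h : IsPrimitive a u v) :
    IsPrimitive a (fun x => c * u x) (fun x => c * v x) := by
  refine ⟨h.1.const_mul c, fun x hx => ?_⟩
  rw [intervalIntegral.integral_const_mul]
  simp only [h.2 x hx]
  ring

theorem IsPrimitive.congr {a : ℝ} {u v w : ℝ → ℂ} (h : IsPrimitive a u v)
    (hvw : v =ᵐ[mu a] w) : IsPrimitive a u w := by
  have e : ∀ᵐ t ∂volume, t ∈ Ioo (-a) a → v t = w t :=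
    (ae_restrict_iff' measurableSet_Ioo).1 hvw
  have e' : ∀ᵐ t ∂volume, t ≠ a := by simp [ae_iff, measure_singleton]
  refine ⟨h.1.congr hvw, fun x hx => ?_⟩
  rw [h.2 x hx]
  congr 1
  refine intervalIntegral.integral_congr_ae ?_
  filter_upwards [e, e'] with t ht ht' hm
  rw [uIoc_of_le hx.1] at hm
  exact ht ⟨hm.1, lt_of_le_of_ne (hm.2.trans hx.2) ht'⟩

theorem IsPrimitive.ae_eq_zero {a : ℝ} {u v : ℝ → ℂ} (h : IsPrimitive a u v)
    (hu : u =ᵐ[mu a] fun _ => 0) : v =ᵐ[mu a] fun _ => 0 := by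
  rcases le_or_gt a (-a) with ha | ha
  · have : mu a = 0 := by simp [mu, Ioo_eq_empty (not_lt.2 ha)]
    rw [this]; simp [Filter.EventuallyEq]
  have hcont : ContinuousOn u (Ioo (-a) a) := by
    have h1 : ContinuousOn (fun x => u (-a) + ∫ t in (-a)..x, v t) (Icc (-a) a) := by
      refine continuousOn_const.add ?_
      have := intervalIntegral.continuousOn_primitive_interval'
        (intervalIntegrable_of_integrable h.1 ha.le)
        (left_mem_uIcc : -a ∈ uIcc (-a) a)
      rwa [uIcc_of_le ha.le] at this
    exact (h1.congr h.2).mono Ioo_subset_Icc_self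
  have hzero : EqOn u (fun _ => 0) (Ioo (-a) a) :=
    Measure.eqOn_open_of_ae_eq hu isOpen_Ioo hcont continuousOn_const
  refine (ae_restrict_iff' measurableSet_Ioo).2 ?_
  filter_upwards [(intervalIntegrable_of_integrable h.1 ha.le).ae_hasDerivAt_integral] with x hx hm
  have h1 := hx (by rw [uIcc_of_le ha.le]; exact Ioo_subset_Icc_self hm) (-a) left_mem_uIcc
  have h2 : HasDerivAt (fun x => ∫ t in (-a)..x, v t) 0 x := by
    refine (hasDerivAt_const x (-u (-a))).congr_of_eventuallyEq ?_
    filter_upwards [Ioo_mem_nhds hm.1 hm.2] with y hy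
    have := h.2 y (Ioo_subset_Icc_self hy)
    rw [hzero hy] at this
    exact (neg_eq_of_add_eq_zero_right this.symm).symm
  exact h1.unique h2

/-- The graph of the operator `H ψ = -ψ''` in `L²(-a, a)` with domain
`{ψ ∈ W^{2,2}(-a, a) : ψ'(±a) + c± ψ(±a) = 0}`: here `u` and `v` are the absolutely continuous
representatives of `ψ` and `ψ'`, and `ψ'' = -η ∈ L²(-a, a)`. -/
def graphH (a : ℝ) (cp cm : ℂ) : Submodule ℂ (L2 a × L2 a) where
  carrier := {p | ∃ u v : ℝ → ℂ,
    (p.1 : ℝ → ℂ) =ᵐ[mu a] u ∧ IsPrimitive a u v ∧ IsPrimitive a v (fun x => -(p.2 : ℝ → ℂ) x) ∧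
    v a + cp * u a = 0 ∧ v (-a) + cm * u (-a) = 0}
  zero_mem' := by
    refine ⟨fun _ => 0, fun _ => 0, Lp.coeFn_zero ℂ 2 (mu a), .zero a,
      (IsPrimitive.zero a).congr ?_, by simp, by simp⟩
    filter_upwards [Lp.coeFn_zero ℂ 2 (mu a)] with x hx
    change 0 = -((0 : L2 a) : ℝ → ℂ) x
    rw [hx]; simp
  add_mem' := by
    rintro ⟨p, q⟩ ⟨p', q'⟩ ⟨u, v, h1, h2, h3, h4, h5⟩ ⟨u', v', h1', h2', h3', h4', h5'⟩
    refine ⟨fun x => u x + u' x, fun x => v x + v' x, ?_, h2.add h2', (h3.add h3').congr ?_,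
      by linear_combination h4 + h4', by linear_combination h5 + h5'⟩
    · filter_upwards [h1, h1', Lp.coeFn_add p p'] with x e1 e2 e3
      change ((p + p' : L2 a) : ℝ → ℂ) x = _
      rw [e3, Pi.add_apply, ← e1, ← e2]
    · filter_upwards [Lp.coeFn_add q q'] with x e3
      change _ = -((q + q' : L2 a) : ℝ → ℂ) x
      rw [e3, Pi.add_apply]; ring
  smul_mem' := by
    rintro c ⟨p, q⟩ ⟨u, v, h1, h2, h3, h4, h5⟩
    refine ⟨fun x => c * u x, fun x => c * v x, ?_, h2.smul c, (h3.smul c).congr ?_,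
      by linear_combination c * h4, by linear_combination c * h5⟩
    · filter_upwards [h1, Lp.coeFn_smul c p] with x e1 e3
      change ((c • p : L2 a) : ℝ → ℂ) x = _
      rw [e3, Pi.smul_apply, smul_eq_mul, ← e1]
    · filter_upwards [Lp.coeFn_smul c q] with x e3
      change _ = -((c • q : L2 a) : ℝ → ℂ) x
      rw [e3, Pi.smul_apply, smul_eq_mul]; ring

/-- The operator `H` with boundary constants `c₊ = cp`, `c₋ = cm`, as an unbounded operator. -/
def opH (a : ℝ) (cp cm : ℂ) : L2 a →ₗ.[ℂ] L2 a := (graphH a cp cm).toLinearPMap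

/-- `graphH` is single-valued, so that it is the graph of `opH`. -/
theorem opH_graph (a : ℝ) (cp cm : ℂ) : (opH a cp cm).graph = graphH a cp cm := by
  refine Submodule.toLinearPMap_graph_eq _ ?_
  rintro ⟨p, q⟩ ⟨u, v, h1, h2, h3, -, -⟩ hp
  obtain rfl : p = 0 := hp
  have hu : u =ᵐ[mu a] fun _ => 0 := h1.symm.trans (Lp.coeFn_zero ℂ 2 (mu a))
  have hq := h3.ae_eq_zero (h2.ae_eq_zero hu)
  change q = 0
  refine (Lp.eq_zero_iff_ae_eq_zero).2 ?_
  filter_upwards [hq] with x hx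
  simpa using hx

/-! ### Metric operators -/

/-- `S⁻¹ T S`, on its natural domain `{f : S f ∈ Dom T}`, for a boundedly invertible `S`. -/
def conjBy {E : Type*} [NormedAddCommGroup E] [InnerProductSpace ℂ E]
    (S : E ≃L[ℂ] E) (T : E →ₗ.[ℂ] E) : E →ₗ.[ℂ] E where
  domain := T.domain.comap (S : E →ₗ[ℂ] E)
  toFun := (S.symm : E →ₗ[ℂ] E) ∘ₗ T.toFun ∘ₗ
    (S : E →ₗ[ℂ] E).restrict (p := T.domain.comap (S : E →ₗ[ℂ] E)) (q := T.domain)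
      (fun _ h => h)

/-- `Θ` is a metric operator for `T`: it is bounded, positive (`⟨f, Θ f⟩ > 0` for `f ≠ 0`), has
a bounded inverse, and `T = Θ⁻¹ T* Θ` as unbounded operators. -/
def IsMetricOperator {E : Type*} [NormedAddCommGroup E] [InnerProductSpace ℂ E] [CompleteSpace E]
    (T : E →ₗ.[ℂ] E) (Θ : E →L[ℂ] E) : Prop :=
  (∀ f : E, f ≠ 0 → 0 < inner ℂ f (Θ f)) ∧
    ∃ S : E ≃L[ℂ] E, (S : E →L[ℂ] E) = Θ ∧ T = conjBy S T.adjoint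

/-! ### The functions `χ_n^D`, `χ_n^N`, `φ_n` -/

/-- `k_n = n π / (2 a)`. -/
def kn (a : ℝ) (n : ℕ) : ℝ := n * Real.pi / (2 * a)

/-- The Dirichlet functions `χ_n^D`, with `χ_0^D = 0`. -/
def chiD (a : ℝ) (n : ℕ) (x : ℝ) : ℂ :=
  ((1 / Real.sqrt a * Real.sin (kn a n * (x + a)) : ℝ) : ℂ)

/-- The Neumann functions `χ_n^N`. -/
def chiN (a : ℝ) (n : ℕ) (x : ℝ) : ℂ :=
  if n = 0 then ((1 / Real.sqrt (2 * a) : ℝ) : ℂ)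
  else ((1 / Real.sqrt a * Real.cos (kn a n * (x + a)) : ℝ) : ℂ)

/-- The eigenfunctions `φ_n` of `H*` for `c± = i α`. -/
def phi (a α : ℝ) (n : ℕ) (x : ℝ) : ℂ :=
  if n = 0 then ((1 / Real.sqrt (2 * a) : ℝ) : ℂ) * Complex.exp (Complex.I * α * (x + a))
  else chiN a n x + Complex.I * (α / kn a n : ℝ) * chiD a n x

theorem continuous_chiD (a : ℝ) (n : ℕ) : Continuous (chiD a n) := by
  unfold chiD; fun_prop

theorem continuous_chiN (a : ℝ) (n : ℕ) : Continuous (chiN a n) := by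
  unfold chiN; split_ifs <;> fun_prop

theorem continuous_phi (a α : ℝ) (n : ℕ) : Continuous (phi a α n) := by
  have h1 := continuous_chiD a n
  have h2 := continuous_chiN a n
  unfold phi; split_ifs <;> fun_prop

theorem memLp_of_continuous (a : ℝ) {f : ℝ → ℂ} (hf : Continuous f) : MemLp f 2 (mu a) := by
  obtain ⟨C, hC⟩ := (isCompact_Icc (a := -a) (b := a)).exists_bound_of_continuousOn
    hf.continuousOn
  refine MemLp.of_bound hf.aestronglyMeasurable C ?_
  exact (ae_restrict_iff' measurableSet_Ioo).2
    (Eventually.of_forall fun x hx => hC x (Ioo_subset_Icc_self hx))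

/-- The class in `L²(-a, a)` of a continuous function. -/
def toL2 (a : ℝ) (f : ℝ → ℂ) (hf : Continuous f) : L2 a := (memLp_of_continuous a hf).toLp f

def chiDL2 (a : ℝ) (n : ℕ) : L2 a := toL2 a (chiD a n) (continuous_chiD a n)

def chiNL2 (a : ℝ) (n : ℕ) : L2 a := toL2 a (chiN a n) (continuous_chiN a n)

def phiL2 (a α : ℝ) (n : ℕ) : L2 a := toL2 a (phi a α n) (continuous_phi a α n)

/-- `T = ∑_{n ≥ 0} C_n² e_n ⟨e_n, ·⟩`, the series converging strongly. -/
def IsStrongSum {E : Type*} [NormedAddCommGroup E] [InnerProductSpace ℂ E]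
    (C : ℕ → ℝ) (e : ℕ → E) (T : E →L[ℂ] E) : Prop :=
  ∀ f : E, Tendsto
    (fun N : ℕ => ∑ n ∈ Finset.range N, ((C n : ℂ) ^ 2 * inner ℂ (e n) f) • e n)
    atTop (𝓝 (T f))

/-! ### The integral operators `θ₁`, `θ₂`, `θ₃` -/

/-- `T` is the integral operator on `L²(-a, a)` with kernel `K`. -/
def IsIntegralOperator (a : ℝ) (K : ℝ → ℝ → ℂ) (T : L2 a →L[ℂ] L2 a) : Prop :=
  ∀ f : L2 a, ∀ᵐ x ∂(mu a), Integrable (fun y => K x y * f y) (mu a) ∧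
    (T f : ℝ → ℂ) x = ∫ y, K x y * f y ∂(mu a)

def theta1 (a α x y : ℝ) : ℂ :=
  Complex.I / a * Complex.exp (Complex.I * α / 2 * (x - y)) * (Real.sin (α / 2 * (x - y)) : ℝ)

def theta2 (a α x y : ℝ) : ℂ :=
  Complex.I * α / (2 * a) * (y - a * Real.sign (y - x))

def theta3 (a α x y : ℝ) : ℂ :=
  (α : ℂ) ^ 2 / (2 * a) * ((a : ℂ) ^ 2 - x * y) - Complex.I * α / (2 * a) * x
    - Complex.I * α / 2 * (1 - Complex.I * α * (y - x)) * Real.sign (y - x)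

end PTRobin

end

noncomputable section
namespace PTRobin
open scoped ComplexConjugate

/-! Decomposition. In coefficients, the formula for `Θ` comes down to what the adjoints of the
integral operators do to the trigonometric functions. For `n ≥ 1`, `θ₂*` sends `χ_n^N` to `i(α/k_n)
χ_n^D` and `θ₃*` sends `χ_n^D` to `-i(α/k_n) φ_n`. Moreover `θ₂*` kills `χ_0^N`, and `θ₁` replaces
the rank-one term of `χ_0^N` by that of `φ_0`. The partial sums of the two sides therefore agree,
and the strong convergence of `Θ` is inherited from `J^N` and `J^D` (`isStrongSum_phi`).

Frame bound. Up to a constant function, `1 + θ₂` is `f ↦ f + iα ∫ f`, a Volterra operator that an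
integrating factor inverts. Hence the coefficients `⟨φ_n, f⟩` are the Neumann coefficients of some
`g`, and `g` determines `f` modulo the exponential `expo`. This exponential is orthogonal to every
`φ_n` with `n ≥ 1`; its pairing with `φ_0` is a multiple of `∫ exp(-2iα(x+a))`, which vanishes
exactly when `|α| = k_n` for some `n ≥ 1` (`inner_phi_zero_expo`). In that case `Θ` annihilates
`expo` and is not positive. Otherwise `‖f‖ ≤ D ‖g‖` (`exists_neumann_coefficients`), and Parseval's
identity for the Neumann basis makes `Θ` coercive.

Intertwining. When `|α|` avoids all `k_n`, the graph of `H` is described by `⟨φ_n, g⟩ = λ_n ⟨φ_n,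
f⟩` for all `n` (`mem_graphH_of_inner_phi` gives the hard direction), and the conjugates of the
`φ_n` form a biorthogonal system of eigenvectors of `H`. The equality `H = Θ⁻¹ H* Θ` is then a
statement about diagonal operators with real eigenvalues (`isMetricOperator_of_biorthogonal`). -/

/-! ### Integrals and inner products in `L²(-a, a)` -/

theorem integral_mu {a : ℝ} (ha : 0 < a) (f : ℝ → ℂ) :
    ∫ x, f x ∂(mu a) = ∫ x in (-a)..a, f x := by
  rw [intervalIntegral.integral_of_le (by linarith), integral_Ioc_eq_integral_Ioo]

theorem ae_mu_mem (a : ℝ) : ∀ᵐ x ∂(mu a), x ∈ Ioo (-a) a := ae_restrict_mem measurableSet_Ioo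

theorem coeFn_toL2 (a : ℝ) {u : ℝ → ℂ} (hu : Continuous u) :
    (toL2 a u hu : ℝ → ℂ) =ᵐ[mu a] u := MemLp.coeFn_toLp _

theorem inner_eq_integral {a : ℝ} (f g : L2 a) :
    inner ℂ f g = ∫ x, conj ((f : ℝ → ℂ) x) * (g : ℝ → ℂ) x ∂(mu a) := by
  rw [L2.inner_def]
  simp [RCLike.inner_apply, mul_comm]

theorem inner_toL2_left {a : ℝ} {u : ℝ → ℂ} (hu : Continuous u) (f : L2 a) :
    inner ℂ (toL2 a u hu) f = ∫ x, conj (u x) * (f : ℝ → ℂ) x ∂(mu a) := by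
  rw [inner_eq_integral]
  refine integral_congr_ae ?_
  filter_upwards [coeFn_toL2 a hu] with x hx
  rw [hx]

theorem inner_toL2_toL2 {a : ℝ} (ha : 0 < a) {u w : ℝ → ℂ} (hu : Continuous u)
    (hw : Continuous w) :
    inner ℂ (toL2 a u hu) (toL2 a w hw) = ∫ x in (-a)..a, conj (u x) * w x := by
  rw [inner_toL2_left, ← integral_mu ha]
  refine integral_congr_ae ?_
  filter_upwards [coeFn_toL2 a hw] with x hx
  rw [hx]

theorem integrable_coeFn {a : ℝ} (f : L2 a) : Integrable (f : ℝ → ℂ) (mu a) :=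
  (Lp.memLp f).integrable (by norm_num)

theorem integrable_mu_of_continuous (a : ℝ) {u : ℝ → ℂ} (hu : Continuous u) :
    Integrable u (mu a) :=
  (memLp_of_continuous a hu).integrable (by norm_num)

theorem Integrable.bdd_mul_mu {a M : ℝ} {k v : ℝ → ℂ} (hk : Measurable k)
    (hM : ∀ x ∈ Ioo (-a) a, ‖k x‖ ≤ M) (hv : Integrable v (mu a)) :
    Integrable (fun x => k x * v x) (mu a) :=
  hv.bdd_mul hk.aestronglyMeasurable ((ae_mu_mem a).mono hM)

theorem Integrable.continuous_mul_mu {a : ℝ} {k v : ℝ → ℂ} (hk : Continuous k)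
    (hv : Integrable v (mu a)) : Integrable (fun x => k x * v x) (mu a) := by
  obtain ⟨C, hC⟩ := (isCompact_Icc (a := -a) (b := a)).exists_bound_of_continuousOn
    hk.continuousOn
  exact Integrable.bdd_mul_mu hk.measurable (fun x hx => hC x (Ioo_subset_Icc_self hx)) hv

theorem norm_integral_kernel_le {a M : ℝ} (hM0 : 0 ≤ M) {k : ℝ → ℂ}
    (hM : ∀ x ∈ Ioo (-a) a, ‖k x‖ ≤ M) (f : L2 a) :
    ‖∫ y, k y * (f : ℝ → ℂ) y ∂(mu a)‖ ≤ M * (measureUnivNNReal (mu a) : ℝ) ^ (2⁻¹ : ℝ) * ‖f‖ := by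
  have h1 : ‖∫ y, k y * (f : ℝ → ℂ) y ∂(mu a)‖ ≤ ∫ y, M * ‖(f : ℝ → ℂ) y‖ ∂(mu a) := by
    refine norm_integral_le_of_norm_le ((integrable_coeFn f).norm.const_mul M) ?_
    filter_upwards [ae_mu_mem a] with y hy
    rw [norm_mul]
    gcongr
    exact hM y hy
  have h2 := eLpNorm_le_eLpNorm_mul_rpow_measure_univ (μ := mu a) (p := 1) (q := 2)
    (by norm_num) (Lp.memLp f).1
  have h3 : ∫ y, ‖(f : ℝ → ℂ) y‖ ∂(mu a) ≤
      ‖f‖ * (measureUnivNNReal (mu a) : ℝ) ^ (2⁻¹ : ℝ) := by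
    rw [integral_norm_eq_lintegral_enorm (Lp.memLp f).1, ← eLpNorm_one_eq_lintegral_enorm,
      Lp.norm_def]
    have h4 := ENNReal.toReal_mono (ENNReal.mul_ne_top (Lp.memLp f).2.ne
      (ENNReal.rpow_ne_top_of_nonneg (by norm_num) (measure_ne_top _ _))) h2
    refine h4.trans (le_of_eq ?_)
    rw [ENNReal.toReal_mul, ← ENNReal.toReal_rpow]
    congr 2
    norm_num
  rw [integral_const_mul] at h1
  calc _ ≤ _ := h1
    _ ≤ M * (‖f‖ * (measureUnivNNReal (mu a) : ℝ) ^ (2⁻¹ : ℝ)) := by gcongr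
    _ = _ := by ring

/-! ### Bounded kernels -/

theorem integrable_kernel_prod {a M : ℝ} {K : ℝ → ℝ → ℂ} (hK : Measurable (Function.uncurry K))
    (hM : ∀ x ∈ Ioo (-a) a, ∀ y ∈ Ioo (-a) a, ‖K x y‖ ≤ M) {v : ℝ → ℂ}
    (hv : Integrable v (mu a)) :
    Integrable (Function.uncurry fun x y => K x y * v y) ((mu a).prod (mu a)) := by
  have h1 : Integrable (fun p : ℝ × ℝ => v p.2) ((mu a).prod (mu a)) := hv.comp_snd (mu a)
  refine h1.bdd_mul (c := M) hK.aestronglyMeasurable ?_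
  rw [Measure.prod_restrict]
  filter_upwards [ae_restrict_mem (measurableSet_Ioo.prod measurableSet_Ioo)] with p hp
  exact hM _ hp.1 _ hp.2

theorem integral_kernel_swap {a M : ℝ} {K : ℝ → ℝ → ℂ} (hK : Measurable (Function.uncurry K))
    (hM : ∀ x ∈ Ioo (-a) a, ∀ y ∈ Ioo (-a) a, ‖K x y‖ ≤ M) {v : ℝ → ℂ}
    (hv : Integrable v (mu a)) :
    ∫ x, ∫ y, K x y * v y ∂(mu a) ∂(mu a) = ∫ y, (∫ x, K x y ∂(mu a)) * v y ∂(mu a) := by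
  rw [integral_integral_swap (integrable_kernel_prod hK hM hv)]
  simp_rw [integral_mul_const]

theorem exists_integralOperator {a M : ℝ} {K : ℝ → ℝ → ℂ}
    (hK : Measurable (Function.uncurry K))
    (hM : ∀ x ∈ Ioo (-a) a, ∀ y ∈ Ioo (-a) a, ‖K x y‖ ≤ M) :
    ∃ T : L2 a →L[ℂ] L2 a, IsIntegralOperator a K T := by
  have hM' : ∀ x ∈ Ioo (-a) a, ∀ y ∈ Ioo (-a) a, ‖K x y‖ ≤ max M 0 :=
    fun x hx y hy => (hM x hx y hy).trans (le_max_left _ _)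
  set D := max M 0 * (measureUnivNNReal (mu a) : ℝ) ^ (2⁻¹ : ℝ) with hD
  have hint : ∀ (f : L2 a), ∀ x ∈ Ioo (-a) a,
      Integrable (fun y => K x y * (f : ℝ → ℂ) y) (mu a) := fun f x hx =>
    Integrable.bdd_mul_mu (hK.comp measurable_prodMk_left) (hM x hx) (integrable_coeFn f)
  have hbd : ∀ (f : L2 a), ∀ᵐ x ∂(mu a),
      ‖∫ y, K x y * (f : ℝ → ℂ) y ∂(mu a)‖ ≤ D * ‖f‖ := fun f =>
    (ae_mu_mem a).mono fun x hx => norm_integral_kernel_le (le_max_right _ _) (hM' x hx) f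
  have hmem : ∀ f : L2 a, MemLp (fun x => ∫ y, K x y * (f : ℝ → ℂ) y ∂(mu a)) 2 (mu a) :=
    fun f => MemLp.of_bound
      (integrable_kernel_prod hK hM (integrable_coeFn f)).aestronglyMeasurable.integral_prod_right'
      _ (hbd f)
  let T : L2 a →ₗ[ℂ] L2 a :=
    { toFun := fun f => (hmem f).toLp _
      map_add' := fun f g => by
        rw [← MemLp.toLp_add]
        refine MemLp.toLp_congr _ _ ?_
        filter_upwards [ae_mu_mem a] with x hx
        rw [Pi.add_apply, ← integral_add (hint f x hx) (hint g x hx)]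
        refine integral_congr_ae ?_
        filter_upwards [Lp.coeFn_add f g] with y hy
        rw [hy, Pi.add_apply, mul_add]
      map_smul' := fun c f => by
        rw [RingHom.id_apply, ← MemLp.toLp_const_smul]
        refine MemLp.toLp_congr _ _ (Eventually.of_forall fun x => ?_)
        rw [Pi.smul_apply, smul_eq_mul, ← integral_const_mul]
        refine integral_congr_ae ?_
        filter_upwards [Lp.coeFn_smul c f] with y hy
        rw [hy, Pi.smul_apply, smul_eq_mul]
        ring }
  refine ⟨T.mkContinuous ((measureUnivNNReal (mu a) : ℝ) ^ ((2 : ENNReal).toReal⁻¹) * D)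
    fun f => ?_, fun f => ?_⟩
  · have hD0 : 0 ≤ D := by positivity
    refine (Lp.norm_le_of_ae_bound (C := D * ‖f‖) (by positivity) ?_).trans_eq (by ring)
    filter_upwards [(hmem f).coeFn_toLp, hbd f] with x h1 h2
    change ‖((hmem f).toLp _ : ℝ → ℂ) x‖ ≤ _
    rwa [h1]
  · filter_upwards [ae_mu_mem a, (hmem f).coeFn_toLp] with x h1 h2
    exact ⟨hint f x h1, h2⟩

/-- By Fubini, the hypothesis `h` says that `T* u = w`. This is how every action of `θ₂` and `θ₃` on
a basis function is computed. -/
theorem inner_integralOperator {a M : ℝ} {K : ℝ → ℝ → ℂ} {T : L2 a →L[ℂ] L2 a}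
    (hT : IsIntegralOperator a K T)
    (hK : Measurable (Function.uncurry K))
    (hM : ∀ x ∈ Ioo (-a) a, ∀ y ∈ Ioo (-a) a, ‖K x y‖ ≤ M)
    {u w : ℝ → ℂ} (hu : Continuous u) (hw : Continuous w)
    (h : ∀ y ∈ Ioo (-a) a, ∫ x, conj (u x) * K x y ∂(mu a) = conj (w y)) (f : L2 a) :
    inner ℂ (toL2 a u hu) (T f) = inner ℂ (toL2 a w hw) f := by
  obtain ⟨C, hC⟩ := (isCompact_Icc (a := -a) (b := a)).exists_bound_of_continuousOn
    hu.continuousOn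
  rw [inner_toL2_left, inner_toL2_left]
  have h1 : ∫ x, conj (u x) * (T f : ℝ → ℂ) x ∂(mu a) =
      ∫ x, ∫ y, (conj (u x) * K x y) * (f : ℝ → ℂ) y ∂(mu a) ∂(mu a) := by
    refine integral_congr_ae ?_
    filter_upwards [hT f] with x hx
    rw [hx.2, ← integral_const_mul]
    simp_rw [mul_assoc]
  rw [h1, integral_kernel_swap (M := C * M) ?_ ?_ (integrable_coeFn f)]
  · refine integral_congr_ae ?_
    filter_upwards [ae_mu_mem a] with y hy
    rw [h y hy]
  · exact ((Complex.continuous_conj.comp hu).measurable.comp measurable_fst).mul hK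
  · intro x hx y hy
    rw [norm_mul, Complex.norm_conj]
    have := hC x (Ioo_subset_Icc_self hx)
    exact mul_le_mul this (hM x hx y hy) (norm_nonneg _) ((norm_nonneg _).trans this)

theorem measurable_sign : Measurable Real.sign := by
  unfold Real.sign
  refine Measurable.ite measurableSet_Iio measurable_const ?_
  exact Measurable.ite measurableSet_Ioi measurable_const measurable_const

theorem abs_sign_le_one (x : ℝ) : |Real.sign x| ≤ 1 := by
  rcases Real.sign_apply_eq x with h | h | h <;> rw [h] <;> simp

/-! ### Primitives -/

/-- Writing a primitive as an integral over the whole interval against a bounded kernel makes Fubini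
for kernels available to Volterra integrals. -/
theorem integral_Iio_kernel {a : ℝ} {v : ℝ → ℂ} {s : ℝ} (hs : s ∈ Icc (-a) a) :
    ∫ y, (if y < s then 1 else 0) * v y ∂(mu a) = ∫ t in (-a)..s, v t := by
  have h : (fun y => (if y < s then (1 : ℂ) else 0) * v y) = (Iio s).indicator v := by
    ext y; by_cases hy : y < s <;> simp [hy]
  rw [h, integral_indicator measurableSet_Iio, Measure.restrict_restrict measurableSet_Iio,
    intervalIntegral.integral_of_le hs.1, integral_Ioc_eq_integral_Ioo]
  congr 2
  ext y
  simp only [mem_inter_iff, mem_Iio, mem_Ioo]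
  constructor
  · rintro ⟨h1, h2, h3⟩; exact ⟨h2, h1⟩
  · rintro ⟨h1, h2⟩; exact ⟨h2, h1, h2.trans_le hs.2⟩

theorem IsPrimitive.of_hasDerivAt {a : ℝ} {u v : ℝ → ℂ} (hv : Continuous v)
    (h : ∀ x, HasDerivAt u (v x) x) : IsPrimitive a u v := by
  refine ⟨integrable_mu_of_continuous a hv, fun x _ => ?_⟩
  rw [intervalIntegral.integral_eq_sub_of_hasDerivAt (fun x _ => h x)
    (hv.intervalIntegrable _ _)]
  ring

theorem IsPrimitive.of_integrable {a : ℝ} {v : ℝ → ℂ} (hv : Integrable v (mu a)) (c : ℂ) :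
    IsPrimitive a (fun x => c + ∫ t in (-a)..x, v t) v :=
  ⟨hv, fun x _ => by simp⟩

theorem IsPrimitive.continuousOn {a : ℝ} (ha : 0 < a) {u v : ℝ → ℂ} (h : IsPrimitive a u v) :
    ContinuousOn u (Icc (-a) a) := by
  have h1 : ContinuousOn (fun x => u (-a) + ∫ t in (-a)..x, v t) (Icc (-a) a) := by
    refine continuousOn_const.add ?_
    have := intervalIntegral.continuousOn_primitive_interval'
      (intervalIntegrable_of_integrable h.1 (by linarith))
      (left_mem_uIcc : -a ∈ uIcc (-a) a)
    rwa [uIcc_of_le (by linarith)] at this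
  exact h1.congr h.2

theorem IsPrimitive.memLp {a : ℝ} (ha : 0 < a) {u v : ℝ → ℂ} (h : IsPrimitive a u v) :
    MemLp u 2 (mu a) := by
  have hc := h.continuousOn ha
  obtain ⟨C, hC⟩ := isCompact_Icc.exists_bound_of_continuousOn hc
  refine MemLp.of_bound ((hc.mono Ioo_subset_Icc_self).aestronglyMeasurable measurableSet_Ioo) C ?_
  exact (ae_mu_mem a).mono fun x hx => hC x (Ioo_subset_Icc_self hx)

/-- Integration by parts of a smooth function against an absolutely continuous one. -/
theorem IsPrimitive.integral_mul {a : ℝ} (ha : 0 < a) {u v : ℝ → ℂ} (h : IsPrimitive a u v)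
    {p q : ℝ → ℂ} (hp : ∀ x, HasDerivAt p (q x) x) (hq : Continuous q) {x : ℝ}
    (hx : x ∈ Icc (-a) a) :
    ∫ t in (-a)..x, p t * v t = p x * u x - p (-a) * u (-a) - ∫ t in (-a)..x, q t * u t := by
  have hpc : Continuous p := continuous_iff_continuousAt.2 fun x => (hp x).continuousAt
  obtain ⟨C, hC⟩ := (isCompact_Icc (a := -a) (b := a)).exists_bound_of_continuousOn
    hq.continuousOn
  have hqi : ∀ y z, ∫ t in y..z, q t = p z - p y := fun y z =>
    intervalIntegral.integral_eq_sub_of_hasDerivAt (fun x _ => hp x) (hq.intervalIntegrable _ _)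
  set K : ℝ → ℝ → ℂ := fun s t => if s < x then (if t < s then q s else 0) else 0 with hK
  have hKm : Measurable (Function.uncurry K) := by
    refine Measurable.ite (measurableSet_lt measurable_fst measurable_const) ?_ measurable_const
    exact Measurable.ite (measurableSet_lt measurable_snd measurable_fst)
      (hq.measurable.comp measurable_fst) measurable_const
  have hKM : ∀ s ∈ Ioo (-a) a, ∀ t ∈ Ioo (-a) a, ‖K s t‖ ≤ C := by
    intro s hs t _
    have := hC s (Ioo_subset_Icc_self hs)
    have h0 := (norm_nonneg _).trans this
    simp only [hK]
    split_ifs <;> simp [this, h0]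
  have hswap := integral_kernel_swap hKm hKM h.1
  have hL : ∫ s, ∫ t, K s t * v t ∂(mu a) ∂(mu a) =
      ∫ s in (-a)..x, q s * (u s - u (-a)) := by
    rw [← integral_Iio_kernel hx]
    refine integral_congr_ae ?_
    filter_upwards [ae_mu_mem a] with s hs
    by_cases hsx : s < x
    · simp only [hK, hsx, if_true, one_mul]
      rw [h.2 s (Ioo_subset_Icc_self hs), add_sub_cancel_left,
        ← integral_Iio_kernel (Ioo_subset_Icc_self hs), ← integral_const_mul]
      congr 1; ext t; split_ifs <;> simp
    · simp [hK, hsx]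
  have hR : ∫ t, (∫ s, K s t ∂(mu a)) * v t ∂(mu a) =
      ∫ t in (-a)..x, (p x - p t) * v t := by
    rw [← integral_Iio_kernel hx]
    refine integral_congr_ae ?_
    filter_upwards [ae_mu_mem a] with t ht
    rw [← mul_assoc]
    congr 1
    have h1 : ∀ s, K s t = (if s < x then 1 else 0) * (if t < s then q s else 0) := by
      intro s; simp only [hK]; split_ifs <;> simp
    simp_rw [h1]
    rw [integral_Iio_kernel hx]
    by_cases htx : t < x
    · rw [if_pos htx, one_mul, ← hqi, intervalIntegral.integral_of_le hx.1,
        intervalIntegral.integral_of_le htx.le]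
      have h2 : (fun s => if t < s then q s else 0) = (Ioi t).indicator q := by
        ext s; simp [indicator]
      rw [h2, integral_indicator measurableSet_Ioi, Measure.restrict_restrict measurableSet_Ioi]
      congr 2
      ext s
      simp only [mem_inter_iff, mem_Ioi, mem_Ioc]
      constructor
      · rintro ⟨h1, h2, h3⟩; exact ⟨h1, h3⟩
      · rintro ⟨h1, h2⟩; exact ⟨h1, ht.1.trans h1, h2⟩
    · rw [if_neg htx, zero_mul]
      refine intervalIntegral.integral_zero_ae (Eventually.of_forall fun s hs => ?_)
      rw [uIoc_of_le hx.1] at hs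
      rw [if_neg (not_lt.2 (hs.2.trans (not_lt.1 htx)))]
  rw [hL, hR] at hswap
  have hv := intervalIntegrable_left h.1 hx
  have hpv : IntervalIntegrable (fun t => p t * v t) volume (-a) x :=
    intervalIntegrable_left (Integrable.continuous_mul_mu hpc h.1) hx
  have hqu : IntervalIntegrable (fun t => q t * u t) volume (-a) x :=
    intervalIntegrable_left (Integrable.continuous_mul_mu hq
      ((h.memLp ha).integrable (by norm_num))) hx
  simp_rw [mul_sub, sub_mul] at hswap
  rw [intervalIntegral.integral_sub hqu (Continuous.intervalIntegrable (by fun_prop) _ _),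
    intervalIntegral.integral_sub (hv.const_mul _) hpv, intervalIntegral.integral_mul_const,
    intervalIntegral.integral_const_mul, hqi] at hswap
  have hux := h.2 x hx
  linear_combination hswap - p x * hux

/-! ### Eigenfunctions of the adjoint operator -/

/-- `p` is a classical eigenfunction, with eigenvalue `l` and derivative `q`, of `-d²/dx²` with
the boundary conditions `p'(±a) = i α p(±a)`. -/
structure IsEigenfunction (a α l : ℝ) (p q : ℝ → ℂ) : Prop where
  hasDerivAt : ∀ x, HasDerivAt p (q x) x
  hasDerivAt' : ∀ x, HasDerivAt q (-(l : ℂ) * p x) x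
  right : q a = Complex.I * α * p a
  left : q (-a) = Complex.I * α * p (-a)

theorem IsEigenfunction.continuous' {a α l : ℝ} {p q : ℝ → ℂ} (h : IsEigenfunction a α l p q) :
    Continuous q := continuous_iff_continuousAt.2 fun x => (h.hasDerivAt' x).continuousAt

theorem IsEigenfunction.conj_hasDerivAt {a α l : ℝ} {p q : ℝ → ℂ} (h : IsEigenfunction a α l p q)
    (x : ℝ) : HasDerivAt (fun x => conj (p x)) (conj (q x)) x := (h.hasDerivAt x).star

theorem IsEigenfunction.conj_hasDerivAt' {a α l : ℝ} {p q : ℝ → ℂ}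
    (h : IsEigenfunction a α l p q) (x : ℝ) :
    HasDerivAt (fun x => conj (q x)) (-(l : ℂ) * conj (p x)) x := by
  have := (h.hasDerivAt' x).star
  simpa using this

theorem IsEigenfunction.conj_boundary {a α l : ℝ} {p q : ℝ → ℂ} (h : IsEigenfunction a α l p q) :
    conj (q a) = -(Complex.I * α * conj (p a)) ∧
      conj (q (-a)) = -(Complex.I * α * conj (p (-a))) := by
  rw [h.right, h.left]
  simp

/-- Complex conjugates of eigenfunctions of `H*` are eigenfunctions of `H`. -/
theorem IsEigenfunction.mem_graphH {a α l : ℝ} {p q : ℝ → ℂ} (h : IsEigenfunction a α l p q)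
    (hc : Continuous fun x => conj (p x)) :
    (toL2 a (fun x => conj (p x)) hc, (l : ℂ) • toL2 a (fun x => conj (p x)) hc) ∈
      graphH a (Complex.I * α) (Complex.I * α) := by
  refine ⟨fun x => conj (p x), fun x => conj (q x), coeFn_toL2 a hc,
    IsPrimitive.of_hasDerivAt (Complex.continuous_conj.comp h.continuous') h.conj_hasDerivAt,
    (IsPrimitive.of_hasDerivAt (continuous_const.mul hc) h.conj_hasDerivAt').congr ?_, ?_, ?_⟩
  · filter_upwards [coeFn_toL2 a hc,
      Lp.coeFn_smul (l : ℂ) (toL2 a (fun x => conj (p x)) hc)] with x h1 h2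
    rw [h2, Pi.smul_apply, h1, smul_eq_mul, Pi.mul_apply, neg_mul]
  · linear_combination h.conj_boundary.1
  · linear_combination h.conj_boundary.2

/-- Two integrations by parts. The conjugate of `p` satisfies the boundary conditions of `H`, so the
boundary terms cancel; `l` is real, so conjugation leaves it unchanged. -/
theorem IsEigenfunction.inner_eq {a α l : ℝ} (ha : 0 < a) {p q : ℝ → ℂ}
    (h : IsEigenfunction a α l p q) (hp : Continuous p) {f g : L2 a}
    (hfg : (f, g) ∈ graphH a (Complex.I * α) (Complex.I * α)) :
    inner ℂ (toL2 a p hp) g = l * inner ℂ (toL2 a p hp) f := by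
  obtain ⟨u, v, h1, h2, h3, h4, h5⟩ := hfg
  have haa : a ∈ Icc (-a) a := ⟨by linarith, le_rfl⟩
  have e1 := h3.integral_mul ha h.conj_hasDerivAt
    (Complex.continuous_conj.comp h.continuous') haa
  have e2 := h2.integral_mul ha h.conj_hasDerivAt'
    (continuous_const.mul (Complex.continuous_conj.comp hp)) haa
  rw [inner_toL2_left, inner_toL2_left]
  have e3 : ∫ x, conj (p x) * (f : ℝ → ℂ) x ∂(mu a) = ∫ x in (-a)..a, conj (p x) * u x := by
    rw [← integral_mu ha]
    refine integral_congr_ae ?_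
    filter_upwards [h1] with x hx
    rw [hx]
  simp only [mul_neg, intervalIntegral.integral_neg, neg_mul, mul_assoc,
    intervalIntegral.integral_const_mul] at e1 e2
  rw [e3, integral_mu ha]
  obtain ⟨b1, b2⟩ := h.conj_boundary
  rw [b1, b2] at e2
  linear_combination -e1 + e2 - conj (p a) * h4 + conj (p (-a)) * h5

/-- The eigenvalue of `H` and `H*` attached to `φ_n`. -/
def eigenvalue (a α : ℝ) (n : ℕ) : ℝ := if n = 0 then α ^ 2 else kn a n ^ 2

theorem kn_ne_zero {a : ℝ} (ha : 0 < a) {n : ℕ} (hn : n ≠ 0) : kn a n ≠ 0 := by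
  unfold kn
  have := Real.pi_ne_zero
  positivity

theorem kn_mul {a : ℝ} (ha : 0 < a) (n : ℕ) : kn a n * (a + a) = n * Real.pi := by
  unfold kn; field_simp; ring

theorem exists_isEigenfunction_phi {a : ℝ} (ha : 0 < a) (α : ℝ) (n : ℕ) :
    ∃ q, IsEigenfunction a α (eigenvalue a α n) (phi a α n) q := by
  rcases eq_or_ne n 0 with rfl | hn
  · have key : ∀ x : ℝ, HasDerivAt (phi a α 0) (Complex.I * α * phi a α 0 x) x := by
      intro x
      have h1 : HasDerivAt (fun x : ℝ => Complex.I * α * ((x : ℂ) + a)) (Complex.I * α * 1) x :=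
        ((Complex.ofRealCLM.hasDerivAt (x := x)).add_const (a : ℂ)).const_mul _
      have h2 := (h1.cexp).const_mul ((1 / Real.sqrt (2 * a) : ℝ) : ℂ)
      have h3 : phi a α 0 = fun x : ℝ => ((1 / Real.sqrt (2 * a) : ℝ) : ℂ) *
          Complex.exp (Complex.I * α * (x + a)) := by ext; simp [phi]
      rw [h3]
      convert! h2 using 1
      ring
    refine ⟨fun x => Complex.I * α * phi a α 0 x, key, fun x => ?_, rfl, rfl⟩
    convert! (key x).const_mul (Complex.I * α) using 1
    simp only [eigenvalue, if_true]
    push_cast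
    linear_combination (-(α : ℂ) ^ 2 * phi a α 0 x) * Complex.I_sq
  · set k := kn a n with hk
    have hk0 : k ≠ 0 := kn_ne_zero ha hn
    have hkc : (k : ℂ) ≠ 0 := Complex.ofReal_ne_zero.2 hk0
    set s := 1 / Real.sqrt a
    have hlin : ∀ x : ℝ, HasDerivAt (fun x : ℝ => k * (x + a)) k x := fun x => by
      simpa using ((hasDerivAt_id x).add_const a).const_mul k
    have hcos : ∀ x : ℝ, HasDerivAt (fun x : ℝ => ((s * Real.cos (k * (x + a)) : ℝ) : ℂ))
        ((s * (-Real.sin (k * (x + a)) * k) : ℝ) : ℂ) x := fun x =>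
      (((hlin x).cos).const_mul s).ofReal_comp
    have hsin : ∀ x : ℝ, HasDerivAt (fun x : ℝ => ((s * Real.sin (k * (x + a)) : ℝ) : ℂ))
        ((s * (Real.cos (k * (x + a)) * k) : ℝ) : ℂ) x := fun x =>
      (((hlin x).sin).const_mul s).ofReal_comp
    have hphi : phi a α n = fun x : ℝ => ((s * Real.cos (k * (x + a)) : ℝ) : ℂ) +
        Complex.I * (α / k : ℝ) * ((s * Real.sin (k * (x + a)) : ℝ) : ℂ) := by
      ext x; simp [phi, hn, chiN, chiD, s, k]
    rw [hphi]
    refine ⟨fun x => -(k : ℂ) * ((s * Real.sin (k * (x + a)) : ℝ) : ℂ) +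
        Complex.I * α * ((s * Real.cos (k * (x + a)) : ℝ) : ℂ), fun x => ?_, fun x => ?_, ?_, ?_⟩
    · convert! (hcos x).add ((hsin x).const_mul (Complex.I * (α / k : ℝ))) using 1
      push_cast
      field_simp
    · convert! ((hsin x).const_mul (-(k : ℂ))).add ((hcos x).const_mul (Complex.I * α)) using 1
      simp only [eigenvalue, hn, if_false]
      push_cast
      field_simp
      ring
    · have : Real.sin (k * (a + a)) = 0 := by rw [kn_mul ha]; exact Real.sin_nat_mul_pi n
      simp [this]
    · simp

/-! ### The Neumann and Dirichlet systems -/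

theorem integral_cos_int {a : ℝ} (ha : 0 < a) (j : ℤ) :
    ∫ x in (-a)..a, Real.cos (j * Real.pi / (2 * a) * (x + a)) = if j = 0 then 2 * a else 0 := by
  split_ifs with hj
  · subst hj
    simp
    ring
  · have hk : (j * Real.pi / (2 * a) : ℝ) ≠ 0 := by
      have := Real.pi_ne_zero
      have : (j : ℝ) ≠ 0 := by exact_mod_cast hj
      positivity
    have h : ∀ x ∈ uIcc (-a) a, HasDerivAt
        (fun x => Real.sin (j * Real.pi / (2 * a) * (x + a)) / (j * Real.pi / (2 * a)))
        (Real.cos (j * Real.pi / (2 * a) * (x + a))) x := by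
      intro x _
      have h1 : HasDerivAt (fun x : ℝ => (j * Real.pi / (2 * a) : ℝ) * (x + a))
          (j * Real.pi / (2 * a)) x := by
        simpa using ((hasDerivAt_id x).add_const a).const_mul (j * Real.pi / (2 * a) : ℝ)
      have h2 := h1.sin.div_const (j * Real.pi / (2 * a))
      rwa [mul_div_cancel_right₀ _ hk] at h2
    rw [intervalIntegral.integral_eq_sub_of_hasDerivAt h
      (Continuous.intervalIntegrable (by fun_prop) _ _)]
    have h2 : (j * Real.pi / (2 * a) : ℝ) * (a + a) = j * Real.pi := by field_simp; ring
    rw [h2, Real.sin_int_mul_pi]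
    simp

theorem integral_cos_mul_cos {a : ℝ} (ha : 0 < a) (m n : ℕ) :
    ∫ x in (-a)..a, Real.cos (kn a m * (x + a)) * Real.cos (kn a n * (x + a)) =
      if m = n then (if n = 0 then 2 * a else a) else 0 := by
  have h : ∀ x, Real.cos (kn a m * (x + a)) * Real.cos (kn a n * (x + a)) =
      (Real.cos (((m - n : ℤ) : ℝ) * Real.pi / (2 * a) * (x + a)) +
        Real.cos (((m + n : ℤ) : ℝ) * Real.pi / (2 * a) * (x + a))) / 2 := by
    intro x
    have e1 : ((m - n : ℤ) : ℝ) * Real.pi / (2 * a) * (x + a) =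
      kn a m * (x + a) - kn a n * (x + a) := by unfold kn; push_cast; ring
    have e2 : ((m + n : ℤ) : ℝ) * Real.pi / (2 * a) * (x + a) =
      kn a m * (x + a) + kn a n * (x + a) := by unfold kn; push_cast; ring
    rw [e1, e2, Real.cos_sub, Real.cos_add]
    ring
  simp_rw [h]
  rw [intervalIntegral.integral_div, intervalIntegral.integral_add
    (Continuous.intervalIntegrable (by fun_prop) _ _)
    (Continuous.intervalIntegrable (by fun_prop) _ _), integral_cos_int ha, integral_cos_int ha]
  split_ifs <;> first | omega | ring

theorem integral_sin_mul_sin {a : ℝ} (ha : 0 < a) (m n : ℕ) (hn : n ≠ 0) :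
    ∫ x in (-a)..a, Real.sin (kn a m * (x + a)) * Real.sin (kn a n * (x + a)) =
      if m = n then a else 0 := by
  have h : ∀ x, Real.sin (kn a m * (x + a)) * Real.sin (kn a n * (x + a)) =
      (Real.cos (((m - n : ℤ) : ℝ) * Real.pi / (2 * a) * (x + a)) -
        Real.cos (((m + n : ℤ) : ℝ) * Real.pi / (2 * a) * (x + a))) / 2 := by
    intro x
    have e1 : ((m - n : ℤ) : ℝ) * Real.pi / (2 * a) * (x + a) =
      kn a m * (x + a) - kn a n * (x + a) := by unfold kn; push_cast; ring
    have e2 : ((m + n : ℤ) : ℝ) * Real.pi / (2 * a) * (x + a) =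
      kn a m * (x + a) + kn a n * (x + a) := by unfold kn; push_cast; ring
    rw [e1, e2, Real.cos_sub, Real.cos_add]
    ring
  simp_rw [h]
  rw [intervalIntegral.integral_div, intervalIntegral.integral_sub
    (Continuous.intervalIntegrable (by fun_prop) _ _)
    (Continuous.intervalIntegrable (by fun_prop) _ _), integral_cos_int ha, integral_cos_int ha]
  split_ifs <;> first | omega | ring

theorem chiN_eq (a : ℝ) (n : ℕ) (x : ℝ) : chiN a n x =
    (((if n = 0 then 1 / Real.sqrt (2 * a) else 1 / Real.sqrt a) *
      Real.cos (kn a n * (x + a)) : ℝ) : ℂ) := by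
  unfold chiN
  split_ifs with h
  · subst h; simp [kn]
  · rfl

theorem orthonormal_chiN {a : ℝ} (ha : 0 < a) : Orthonormal ℂ (chiNL2 a) := by
  rw [orthonormal_iff_ite]
  intro m n
  unfold chiNL2
  rw [inner_toL2_toL2 ha]
  simp_rw [chiN_eq, Complex.conj_ofReal, ← Complex.ofReal_mul, intervalIntegral.integral_ofReal]
  simp only [mul_mul_mul_comm _ (Real.cos _) _ (Real.cos _)]
  rw [intervalIntegral.integral_const_mul, integral_cos_mul_cos ha]
  have h1 : Real.sqrt a ^ 2 = a := Real.sq_sqrt ha.le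
  have h2 : Real.sqrt (2 * a) ^ 2 = 2 * a := Real.sq_sqrt (by linarith)
  have h3 : Real.sqrt a ≠ 0 := (Real.sqrt_pos.2 ha).ne'
  have h4 : Real.sqrt (2 * a) ≠ 0 := (Real.sqrt_pos.2 (by linarith)).ne'
  by_cases hmn : m = n
  · subst hmn
    rw [if_pos rfl, if_pos rfl]
    norm_cast
    split_ifs
    · rw [div_mul_div_comm, ← sq (Real.sqrt _), h2]; field_simp
    · rw [div_mul_div_comm, ← sq (Real.sqrt _), h1]; field_simp
  · rw [if_neg hmn, if_neg hmn, mul_zero, Complex.ofReal_zero]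

theorem orthonormal_chiD {a : ℝ} (ha : 0 < a) : Orthonormal ℂ fun n => chiDL2 a (n + 1) := by
  rw [orthonormal_iff_ite]
  intro m n
  unfold chiDL2
  rw [inner_toL2_toL2 ha]
  unfold chiD
  simp_rw [Complex.conj_ofReal, ← Complex.ofReal_mul, intervalIntegral.integral_ofReal]
  simp only [mul_mul_mul_comm _ (Real.sin _) _ (Real.sin _)]
  rw [intervalIntegral.integral_const_mul, integral_sin_mul_sin ha _ _ n.succ_ne_zero]
  have h1 : Real.sqrt a ^ 2 = a := Real.sq_sqrt ha.le
  have h3 : Real.sqrt a ≠ 0 := (Real.sqrt_pos.2 ha).ne'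
  by_cases hmn : m = n
  · subst hmn
    rw [if_pos rfl, if_pos rfl, div_mul_div_comm, ← sq (Real.sqrt _), h1]
    field_simp
    simp
  · rw [if_neg hmn, if_neg (by omega), mul_zero, Complex.ofReal_zero]

/-! ### Completeness of the Neumann system -/

section Complete

variable {a : ℝ} {f : L2 a}

theorem integral_cos_mul_eq_zero (hf : ∀ n, inner ℂ (chiNL2 a n) f = 0)
    (ha : 0 < a) (j : ℤ) :
    ∫ x, ((Real.cos (j * Real.pi / (2 * a) * (x + a)) : ℝ) : ℂ) * (f : ℝ → ℂ) x ∂(mu a) = 0 := by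
  have h := hf j.natAbs
  unfold chiNL2 at h
  rw [inner_toL2_left] at h
  have hc : ∀ x, Real.cos (kn a j.natAbs * (x + a)) =
      Real.cos (j * Real.pi / (2 * a) * (x + a)) := by
    intro x
    rcases Int.natAbs_eq j with hj | hj
    · congr 1
      have : (j : ℝ) = (j.natAbs : ℕ) := by rw [← Int.cast_natCast, ← hj]
      rw [this]; rfl
    · rw [← Real.cos_neg]
      congr 1
      have : (j : ℝ) = -((j.natAbs : ℕ) : ℝ) := by rw [← Int.cast_natCast, ← Int.cast_neg, ← hj]
      rw [this]; unfold kn; ring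
  simp_rw [chiN_eq, Complex.conj_ofReal, Complex.ofReal_mul, mul_assoc, integral_const_mul,
    hc] at h
  refine (mul_eq_zero.1 h).resolve_left ?_
  have h3 : Real.sqrt a ≠ 0 := (Real.sqrt_pos.2 ha).ne'
  have h4 : Real.sqrt (2 * a) ≠ 0 := (Real.sqrt_pos.2 (by linarith)).ne'
  rw [← ne_eq, Complex.ofReal_ne_zero]
  split_ifs <;> positivity

/-- Product-to-sum formulas absorb one power of the cosine at a time. Frequencies are integers so
that the shift to `j - 1` is always allowed. -/
theorem integral_cos_pow_mul_eq_zero (hf : ∀ n, inner ℂ (chiNL2 a n) f = 0)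
    (ha : 0 < a) (m : ℕ) (j : ℤ) :
    ∫ x, ((Real.cos (Real.pi / (2 * a) * (x + a)) ^ m *
      Real.cos (j * Real.pi / (2 * a) * (x + a)) : ℝ) : ℂ) * (f : ℝ → ℂ) x ∂(mu a) = 0 := by
  induction m generalizing j with
  | zero => simpa using integral_cos_mul_eq_zero hf ha j
  | succ m ih =>
    have h : ∀ x : ℝ, ((Real.cos (Real.pi / (2 * a) * (x + a)) ^ (m + 1) *
        Real.cos (j * Real.pi / (2 * a) * (x + a)) : ℝ) : ℂ) * (f : ℝ → ℂ) x =
      (1 / 2) * (((Real.cos (Real.pi / (2 * a) * (x + a)) ^ m *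
        Real.cos ((j + 1 : ℤ) * Real.pi / (2 * a) * (x + a)) : ℝ) : ℂ) * (f : ℝ → ℂ) x) +
      (1 / 2) * (((Real.cos (Real.pi / (2 * a) * (x + a)) ^ m *
        Real.cos ((j - 1 : ℤ) * Real.pi / (2 * a) * (x + a)) : ℝ) : ℂ) * (f : ℝ → ℂ) x) := by
      intro x
      have e1 : ((j + 1 : ℤ) : ℝ) * Real.pi / (2 * a) * (x + a) =
        j * Real.pi / (2 * a) * (x + a) + Real.pi / (2 * a) * (x + a) := by push_cast; ring
      have e2 : ((j - 1 : ℤ) : ℝ) * Real.pi / (2 * a) * (x + a) =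
        j * Real.pi / (2 * a) * (x + a) - Real.pi / (2 * a) * (x + a) := by push_cast; ring
      rw [e1, e2, Real.cos_add, Real.cos_sub]
      simp only [Complex.ofReal_mul, Complex.ofReal_pow, Complex.ofReal_add, Complex.ofReal_sub]
      ring
    simp_rw [h]
    have hi : ∀ i : ℤ, Integrable (fun x => ((Real.cos (Real.pi / (2 * a) * (x + a)) ^ m *
        Real.cos (i * Real.pi / (2 * a) * (x + a)) : ℝ) : ℂ) * (f : ℝ → ℂ) x) (mu a) :=
      fun i => Integrable.continuous_mul_mu (by fun_prop) (integrable_coeFn f)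
    rw [integral_add ((hi _).const_mul _) ((hi _).const_mul _), integral_const_mul,
      integral_const_mul, ih, ih]
    simp

theorem integral_polynomial_cos_mul_eq_zero (hf : ∀ n, inner ℂ (chiNL2 a n) f = 0)
    (ha : 0 < a) (p : Polynomial ℝ) :
    ∫ x, ((p.eval (Real.cos (Real.pi / (2 * a) * (x + a))) : ℝ) : ℂ) *
      (f : ℝ → ℂ) x ∂(mu a) = 0 := by
  simp_rw [Polynomial.eval_eq_sum_range, Complex.ofReal_sum, Finset.sum_mul]
  rw [integral_finsetSum]
  · refine Finset.sum_eq_zero fun i _ => ?_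
    simp_rw [Complex.ofReal_mul, mul_assoc]
    rw [integral_const_mul]
    have := integral_cos_pow_mul_eq_zero hf ha i 0
    simp only [Int.cast_zero, zero_mul, zero_div, Real.cos_zero, mul_one] at this
    rw [this, mul_zero]
  · intro i _
    exact Integrable.continuous_mul_mu (by fun_prop) (integrable_coeFn f)

/-- The function `x ↦ cos(π(x+a)/(2a))` is a homeomorphism of `[-a, a]` onto `[-1, 1]`, so by
Weierstrass polynomials in it approximate any continuous `g` uniformly. -/
theorem integral_continuous_mul_eq_zero (hf : ∀ n, inner ℂ (chiNL2 a n) f = 0)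
    (ha : 0 < a) {g : ℝ → ℝ} (hg : Continuous g) :
    ∫ x, (g x : ℂ) * (f : ℝ → ℂ) x ∂(mu a) = 0 := by
  set I := ∫ x, ‖(f : ℝ → ℂ) x‖ ∂(mu a)
  have hbound : ∀ ε > 0, ‖∫ x, (g x : ℂ) * (f : ℝ → ℂ) x ∂(mu a)‖ ≤ ε * I := by
    intro ε hε
    obtain ⟨p, hp⟩ := exists_polynomial_near_of_continuousOn (-1) 1
      -- This is `g` composed with the inverse of that homeomorphism.
      (fun y => g (Real.arccos y * (2 * a / Real.pi) - a))
      (by fun_prop) ε hε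
    have hpi := Real.pi_pos
    have hi1 : Integrable (fun x => (g x : ℂ) * (f : ℝ → ℂ) x) (mu a) :=
      Integrable.continuous_mul_mu (by fun_prop) (integrable_coeFn f)
    have hi2 : Integrable (fun x => ((p.eval (Real.cos (Real.pi / (2 * a) * (x + a))) : ℝ) : ℂ) *
      (f : ℝ → ℂ) x) (mu a) := Integrable.continuous_mul_mu
        (Complex.continuous_ofReal.comp (p.continuous.comp (by fun_prop))) (integrable_coeFn f)
    have h := integral_sub hi1 hi2
    rw [integral_polynomial_cos_mul_eq_zero hf ha, sub_zero] at h
    rw [← h, ← integral_const_mul]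
    refine norm_integral_le_of_norm_le ((integrable_coeFn f).norm.const_mul ε) ?_
    filter_upwards [ae_mu_mem a] with x hx
    rw [← sub_mul, norm_mul, ← Complex.ofReal_sub, Complex.norm_real, norm_sub_rev]
    gcongr
    have hx' : Real.arccos (Real.cos (Real.pi / (2 * a) * (x + a))) * (2 * a / Real.pi) - a = x := by
      have h0 : 0 ≤ x + a := by linarith [hx.1]
      rw [Real.arccos_cos (by positivity)]
      · field_simp; ring
      · rw [div_mul_eq_mul_div, div_le_iff₀ (by positivity)]
        nlinarith [hx.2]
    have := hp _ ⟨Real.neg_one_le_cos (Real.pi / (2 * a) * (x + a)),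
      Real.cos_le_one (Real.pi / (2 * a) * (x + a))⟩
    simp only [hx'] at this
    exact this.le
  have hlim : Tendsto (fun ε : ℝ => ε * I) (𝓝[>] 0) (𝓝 0) := by
    have : Tendsto (fun ε : ℝ => ε * I) (𝓝 0) (𝓝 (0 * I)) :=
      (continuous_id.mul continuous_const).tendsto 0
    rw [zero_mul] at this
    exact this.mono_left nhdsWithin_le_nhds
  have := ge_of_tendsto hlim (eventually_mem_nhdsWithin.mono fun ε hε => hbound ε hε)
  exact norm_le_zero_iff.1 this

theorem eq_zero_of_inner_chiN_eq_zero (ha : 0 < a) (hf : ∀ n, inner ℂ (chiNL2 a n) f = 0) :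
    f = 0 := by
  rw [Lp.eq_zero_iff_ae_eq_zero]
  refine (ae_restrict_iff' measurableSet_Ioo).2 ?_
  have hloc : LocallyIntegrableOn (f : ℝ → ℂ) (Ioo (-a) a) volume :=
    IntegrableOn.locallyIntegrableOn (integrable_coeFn f)
  refine isOpen_Ioo.ae_eq_zero_of_integral_contDiff_smul_eq_zero hloc fun g hg _ hgs => ?_
  rw [← integral_continuous_mul_eq_zero hf ha hg.continuous,
    ← setIntegral_eq_integral_of_forall_compl_eq_zero (s := Ioo (-a) a)]
  · rfl
  · intro x hx
    rw [image_eq_zero_of_notMem_tsupport fun h => hx (hgs h), zero_smul]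

end Complete

/-- The Neumann functions form a Hilbert basis. -/
def neumannBasis {a : ℝ} (ha : 0 < a) : HilbertBasis ℕ ℂ (L2 a) :=
  HilbertBasis.mkOfOrthogonalEqBot (orthonormal_chiN ha) <| by
    rw [Submodule.eq_bot_iff]
    intro f hf
    rw [Submodule.mem_orthogonal] at hf
    exact eq_zero_of_inner_chiN_eq_zero ha fun n => hf _ (Submodule.subset_span ⟨n, rfl⟩)

theorem coe_neumannBasis {a : ℝ} (ha : 0 < a) : ⇑(neumannBasis ha) = chiNL2 a :=
  HilbertBasis.coe_mkOfOrthogonalEqBot _ _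

/-! ### Strong sums -/

/-- Bessel's inequality gives square-summable coefficients, and Banach–Steinhaus makes the pointwise
limit bounded. Orthonormality starts at index `1` because `χ_0^D = 0`; a single initial term does
not affect convergence. -/
theorem exists_isStrongSum {E : Type*} [NormedAddCommGroup E] [InnerProductSpace ℂ E]
    [CompleteSpace E] {C : ℕ → ℝ} {m : ℝ} (hC : ∀ n, |C n| ≤ m) {e : ℕ → E}
    (he : Orthonormal ℂ fun n => e (n + 1)) : ∃ T : E →L[ℂ] E, IsStrongSum C e T := by
  have hsum : ∀ f : E, Summable fun n => ((C n : ℂ) ^ 2 * inner ℂ (e n) f) • e n := by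
    intro f
    rw [← summable_nat_add_iff 1]
    have h1 := he.orthogonalFamily.summable_iff_norm_sq_summable
      (fun n => (C (n + 1) : ℂ) ^ 2 * inner ℂ (e (n + 1)) f)
    simp only [LinearIsometry.toSpanSingleton_apply] at h1
    refine h1.2 (Summable.of_nonneg_of_le (fun _ => by positivity) (fun n => ?_)
      ((he.inner_products_summable f).mul_left (m ^ 4)))
    rw [norm_mul, norm_pow, Complex.norm_real, mul_pow, ← pow_mul]
    gcongr
    exact hC _
  refine ⟨continuousLinearMapOfTendsto
    (fun N : ℕ => ∑ n ∈ Finset.range N, (C n : ℂ) ^ 2 • (innerSL ℂ (e n)).smulRight (e n))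
    (l := atTop) (f := fun f => ∑' n, ((C n : ℂ) ^ 2 * inner ℂ (e n) f) • e n)
    (tendsto_pi_nhds.2 fun f => ?_), fun f => (hsum f).hasSum.tendsto_sum_nat⟩
  refine (hsum f).hasSum.tendsto_sum_nat.congr fun N => ?_
  simp [mul_smul]

/-! ### Kernels with a jump on the diagonal -/

theorem sign_kernel_bounded (a : ℝ) {A B : ℝ → ℝ → ℂ} (hA : Continuous (Function.uncurry A))
    (hB : Continuous (Function.uncurry B)) :
    Measurable (Function.uncurry fun x y => A x y + B x y * (Real.sign (y - x) : ℝ)) ∧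
    ∃ M, ∀ x ∈ Ioo (-a) a, ∀ y ∈ Ioo (-a) a,
      ‖A x y + B x y * (Real.sign (y - x) : ℝ)‖ ≤ M := by
  constructor
  · exact hA.measurable.add (hB.measurable.mul (Complex.measurable_ofReal.comp
      (measurable_sign.comp (measurable_snd.sub measurable_fst))))
  · have hc : IsCompact (Icc (-a) a ×ˢ Icc (-a) a) := isCompact_Icc.prod isCompact_Icc
    obtain ⟨M, hM⟩ := hc.exists_bound_of_continuousOn hA.continuousOn
    obtain ⟨M', hM'⟩ := hc.exists_bound_of_continuousOn hB.continuousOn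
    refine ⟨M + M', fun x hx y hy => ?_⟩
    have hxy : (x, y) ∈ Icc (-a) a ×ˢ Icc (-a) a :=
      ⟨Ioo_subset_Icc_self hx, Ioo_subset_Icc_self hy⟩
    have h1 := hM _ hxy
    have h2 := hM' _ hxy
    refine (norm_add_le _ _).trans (add_le_add h1 ?_)
    rw [norm_mul, Complex.norm_real]
    calc _ ≤ ‖B x y‖ * 1 := by gcongr; exact abs_sign_le_one _
      _ ≤ M' := by rw [mul_one]; exact h2

/-- The sign changes at `x = y`, so the two halves contribute `q y - q (-a)` and `-(q a - q y)`. -/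
theorem integral_sign_kernel {a : ℝ} {A B p q : ℝ → ℂ} (hA : Continuous A) (hB : Continuous B)
    (hp : ∀ x, HasDerivAt p (A x) x) (hq : ∀ x, HasDerivAt q (B x) x) {y : ℝ}
    (hy : y ∈ Ioo (-a) a) :
    ∫ x, (A x + B x * (Real.sign (y - x) : ℝ)) ∂(mu a) =
      p a - p (-a) + 2 * q y - q (-a) - q a := by
  have ha : 0 < a := by linarith [hy.1, hy.2]
  have hint : ∀ c d, IntervalIntegrable (fun x => B x * (Real.sign (y - x) : ℝ)) volume c d := by
    intro c d
    rw [intervalIntegrable_iff]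
    refine (intervalIntegrable_iff.1 (hB.intervalIntegrable c d)).mul_bdd (c := 1) ?_ ?_
    · exact (Complex.measurable_ofReal.comp
        (measurable_sign.comp (measurable_const.sub measurable_id))).aestronglyMeasurable
    · refine Eventually.of_forall fun x => ?_
      rw [Complex.norm_real]
      exact abs_sign_le_one _
  have h1 : ∫ x in (-a)..y, B x * (Real.sign (y - x) : ℝ) = q y - q (-a) := by
    rw [← intervalIntegral.integral_eq_sub_of_hasDerivAt (fun x _ => hq x)
      (hB.intervalIntegrable _ _), intervalIntegral.integral_of_le hy.1.le,
      intervalIntegral.integral_of_le hy.1.le, integral_Ioc_eq_integral_Ioo,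
      integral_Ioc_eq_integral_Ioo]
    refine setIntegral_congr_fun measurableSet_Ioo fun x hx => ?_
    rw [Real.sign_of_pos (by linarith [hx.2])]
    simp
  have h2 : ∫ x in y..a, B x * (Real.sign (y - x) : ℝ) = -(q a - q y) := by
    rw [← intervalIntegral.integral_eq_sub_of_hasDerivAt (fun x _ => hq x)
      (hB.intervalIntegrable _ _), intervalIntegral.integral_of_le hy.2.le,
      intervalIntegral.integral_of_le hy.2.le, ← integral_neg]
    refine setIntegral_congr_fun measurableSet_Ioc fun x hx => ?_
    rw [Real.sign_of_neg (by linarith [hx.1])]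
    simp
  rw [integral_mu ha, intervalIntegral.integral_add (hA.intervalIntegrable _ _) (hint _ _),
    ← intervalIntegral.integral_add_adjacent_intervals (hint _ y) (hint y _), h1, h2,
    intervalIntegral.integral_eq_sub_of_hasDerivAt (fun x _ => hp x) (hA.intervalIntegrable _ _)]
  ring

theorem theta2_eq {a : ℝ} (ha : 0 < a) (α x y : ℝ) : theta2 a α x y =
    Complex.I * α / (2 * a) * y + -(Complex.I * α / 2) * (Real.sign (y - x) : ℝ) := by
  have : (a : ℂ) ≠ 0 := Complex.ofReal_ne_zero.2 ha.ne'
  unfold theta2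
  field_simp
  ring

theorem theta3_eq (a α x y : ℝ) : theta3 a α x y =
    ((α : ℂ) ^ 2 / (2 * a) * ((a : ℂ) ^ 2 - x * y) - Complex.I * α / (2 * a) * x)
    + -(Complex.I * α / 2 * (1 - Complex.I * α * (y - x))) * (Real.sign (y - x) : ℝ) := by
  unfold theta3
  ring

theorem theta2_bounded {a : ℝ} (ha : 0 < a) (α : ℝ) :
    Measurable (Function.uncurry (theta2 a α)) ∧
    ∃ M, ∀ x ∈ Ioo (-a) a, ∀ y ∈ Ioo (-a) a, ‖theta2 a α x y‖ ≤ M := by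
  have h : theta2 a α = fun x y => Complex.I * α / (2 * a) * y +
    -(Complex.I * α / 2) * (Real.sign (y - x) : ℝ) := by ext; exact theta2_eq ha _ _ _
  rw [h]
  refine sign_kernel_bounded a (A := fun _ y => Complex.I * α / (2 * a) * y)
    (B := fun _ _ => -(Complex.I * α / 2)) ?_ ?_
  · simp only [Function.uncurry_def]; fun_prop
  · simp only [Function.uncurry_def]; fun_prop

theorem theta3_bounded (a α : ℝ) :
    Measurable (Function.uncurry (theta3 a α)) ∧
    ∃ M, ∀ x ∈ Ioo (-a) a, ∀ y ∈ Ioo (-a) a, ‖theta3 a α x y‖ ≤ M := by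
  have h : theta3 a α = fun x y =>
    ((α : ℂ) ^ 2 / (2 * a) * ((a : ℂ) ^ 2 - x * y) - Complex.I * α / (2 * a) * x)
    + -(Complex.I * α / 2 * (1 - Complex.I * α * (y - x))) * (Real.sign (y - x) : ℝ) := by
    ext; exact theta3_eq _ _ _ _
  rw [h]
  refine sign_kernel_bounded a
    (A := fun x y => (α : ℂ) ^ 2 / (2 * a) * ((a : ℂ) ^ 2 - x * y) - Complex.I * α / (2 * a) * x)
    (B := fun x y => -(Complex.I * α / 2 * (1 - Complex.I * α * (y - x)))) ?_ ?_
  · simp only [Function.uncurry_def]; fun_prop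
  · simp only [Function.uncurry_def]; fun_prop

theorem theta1_bounded (a α : ℝ) :
    Measurable (Function.uncurry (theta1 a α)) ∧
    ∃ M, ∀ x ∈ Ioo (-a) a, ∀ y ∈ Ioo (-a) a, ‖theta1 a α x y‖ ≤ M := by
  have := sign_kernel_bounded a (A := theta1 a α) (B := fun _ _ => 0)
    (by unfold theta1; simp only [Function.uncurry_def]; fun_prop)
    (by simp only [Function.uncurry_def]; fun_prop)
  simpa using! this

theorem hasDerivAt_ofReal (x : ℝ) : HasDerivAt (fun x : ℝ => (x : ℂ)) 1 x :=
  Complex.ofRealCLM.hasDerivAt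

/-! ### The integral operators on the Neumann and Dirichlet functions -/

theorem hasDerivAt_chiD (a : ℝ) {n : ℕ} (hn : n ≠ 0) (x : ℝ) :
    HasDerivAt (chiD a n) (kn a n * chiN a n x) x := by
  have h := ((((hasDerivAt_id x).add_const a).const_mul (kn a n)).sin.const_mul
    (1 / Real.sqrt a)).ofReal_comp
  convert! h using 1
  simp [chiN, hn]
  ring

theorem hasDerivAt_chiN (a : ℝ) {n : ℕ} (hn : n ≠ 0) (x : ℝ) :
    HasDerivAt (chiN a n) (-(kn a n : ℂ) * chiD a n x) x := by
  have h := ((((hasDerivAt_id x).add_const a).const_mul (kn a n)).cos.const_mul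
    (1 / Real.sqrt a)).ofReal_comp
  convert! h using 1
  · ext x; simp [chiN, hn]
  · simp [chiD]
    ring

theorem chiD_left (a : ℝ) (n : ℕ) : chiD a n (-a) = 0 := by simp [chiD]

theorem chiD_right {a : ℝ} (ha : 0 < a) (n : ℕ) : chiD a n a = 0 := by
  simp [chiD, kn_mul ha, Real.sin_nat_mul_pi]

theorem chiD_zero (a x : ℝ) : chiD a 0 x = 0 := by simp [chiD, kn]

theorem conj_chiD (a : ℝ) (n : ℕ) (x : ℝ) : conj (chiD a n x) = chiD a n x := Complex.conj_ofReal _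

theorem conj_chiN (a : ℝ) (n : ℕ) (x : ℝ) : conj (chiN a n x) = chiN a n x := by
  rw [chiN_eq]; exact Complex.conj_ofReal _

theorem chiN_zero (a x : ℝ) : chiN a 0 x = ((1 / Real.sqrt (2 * a) : ℝ) : ℂ) := by simp [chiN]

section Coefficients

variable {a α : ℝ} {T : L2 a →L[ℂ] L2 a}

/-- The adjoint of `θ₂` sends `χ_n^N` to `i(α/k_n) χ_n^D`, precisely the difference `φ_n - χ_n^N`.
-/
theorem inner_chiN_theta2 (ha : 0 < a) (hT : IsIntegralOperator a (theta2 a α) T) {n : ℕ}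
    (hn : n ≠ 0) (f : L2 a) : inner ℂ (chiNL2 a n) (f + T f) = inner ℂ (phiL2 a α n) f := by
  obtain ⟨hm, M, hM⟩ := theta2_bounded ha α
  have hk : (kn a n : ℂ) ≠ 0 := Complex.ofReal_ne_zero.2 (kn_ne_zero ha hn)
  have ha' : (a : ℂ) ≠ 0 := Complex.ofReal_ne_zero.2 ha.ne'
  have hw : Continuous fun x => Complex.I * (α / kn a n : ℝ) * chiD a n x :=
    continuous_const.mul (continuous_chiD a n)
  have h := inner_integralOperator hT hm hM (continuous_chiN a n) hw (fun y hy => ?_) f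
  · rw [inner_add_right]
    unfold chiNL2
    rw [h, ← inner_add_left]
    congr 1
    unfold phiL2 toL2
    rw [← MemLp.toLp_add]
    refine MemLp.toLp_congr _ _ (Eventually.of_forall fun x => ?_)
    simp [phi, hn]
  · have e := integral_sign_kernel (A := fun x => Complex.I * α / (2 * a) * y * chiN a n x)
      (B := fun x => -(Complex.I * α / 2) * chiN a n x)
      (p := fun x => Complex.I * α / (2 * a) * y * (chiD a n x / kn a n))
      (q := fun x => -(Complex.I * α / 2) * (chiD a n x / kn a n))
      (continuous_const.mul (continuous_chiN a n)) (continuous_const.mul (continuous_chiN a n))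
      (fun x => by
        convert! ((hasDerivAt_chiD a hn x).div_const (kn a n : ℂ)).const_mul
          (Complex.I * α / (2 * a) * y) using 1
        rw [mul_div_cancel_left₀ _ hk])
      (fun x => by
        convert! ((hasDerivAt_chiD a hn x).div_const (kn a n : ℂ)).const_mul
          (-(Complex.I * α / 2)) using 1
        rw [mul_div_cancel_left₀ _ hk]) hy
    simp only [chiD_left, chiD_right ha] at e
    refine (integral_congr_ae (Eventually.of_forall fun x => ?_)).trans (e.trans ?_)
    · rw [conj_chiN, theta2_eq ha, mul_add, mul_comm (chiN a n x) (_ * (y : ℂ)), ← mul_assoc,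
        mul_comm (chiN a n x)]
    · rw [map_mul, map_mul, conj_chiD, Complex.conj_I, Complex.conj_ofReal]
      push_cast
      field_simp
      ring

/-- The adjoint of `θ₂` kills constants: the linear term of the kernel balances its jump. -/
theorem inner_chiN_zero_theta2 (ha : 0 < a) (hT : IsIntegralOperator a (theta2 a α) T)
    (f : L2 a) : inner ℂ (chiNL2 a 0) (f + T f) = inner ℂ (chiNL2 a 0) f := by
  obtain ⟨hm, M, hM⟩ := theta2_bounded ha α
  have ha' : (a : ℂ) ≠ 0 := Complex.ofReal_ne_zero.2 ha.ne'
  have h := inner_integralOperator hT hm hM (continuous_chiN a 0)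
    (continuous_const (y := (0 : ℂ))) (fun y hy => ?_) f
  · rw [inner_add_right]
    unfold chiNL2
    have h0 : inner ℂ (toL2 a (fun _ => 0) continuous_const) f = 0 := by
      rw [inner_toL2_left]; simp
    rw [h, h0, add_zero]
  · set c := ((1 / Real.sqrt (2 * a) : ℝ) : ℂ)
    have hlin : ∀ (b : ℂ) (x : ℝ), HasDerivAt (fun x : ℝ => b * (x : ℂ)) b x := fun b x => by
      simpa using (hasDerivAt_ofReal x).const_mul b
    have e := integral_sign_kernel (A := fun _ => Complex.I * α / (2 * a) * y * c)
      (B := fun _ => -(Complex.I * α / 2) * c)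
      (p := fun x => Complex.I * α / (2 * a) * y * c * x)
      (q := fun x => -(Complex.I * α / 2) * c * x)
      continuous_const continuous_const
      (fun x => hlin _ x) (fun x => hlin _ x) hy
    refine (integral_congr_ae (Eventually.of_forall fun x => ?_)).trans (e.trans ?_)
    · rw [conj_chiN, theta2_eq ha, mul_add, mul_comm (chiN a 0 x) (_ * (y : ℂ)), ← mul_assoc,
        mul_comm (chiN a 0 x), chiN_zero]
    · rw [map_zero]
      push_cast
      field_simp
      ring

theorem hasDerivAt_affine_mul_chiD (ha : 0 < a) {n : ℕ} (hn : n ≠ 0) (p q : ℂ) (x : ℝ) :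
    HasDerivAt (fun x : ℝ => q * chiD a n x / kn a n ^ 2 - (p + q * x) * chiN a n x / kn a n)
      ((p + q * x) * chiD a n x) x := by
  have hk : (kn a n : ℂ) ≠ 0 := Complex.ofReal_ne_zero.2 (kn_ne_zero ha hn)
  have h1 : HasDerivAt (fun x : ℝ => p + q * (x : ℂ)) (q * 1) x :=
    ((hasDerivAt_ofReal x).const_mul q).const_add p
  convert! (((hasDerivAt_chiD a hn x).const_mul q).div_const ((kn a n : ℂ) ^ 2)).sub
    ((h1.mul (hasDerivAt_chiN a hn x)).div_const (kn a n : ℂ)) using 1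
  field_simp
  ring

theorem inner_chiD_theta3 (ha : 0 < a) (hT : IsIntegralOperator a (theta3 a α) T) {n : ℕ}
    (hn : n ≠ 0) (f : L2 a) : inner ℂ (chiDL2 a n) (T f) =
      Complex.I * (α / kn a n : ℝ) * inner ℂ (phiL2 a α n) f := by
  obtain ⟨hm, M, hM⟩ := theta3_bounded a α
  have hk : (kn a n : ℂ) ≠ 0 := Complex.ofReal_ne_zero.2 (kn_ne_zero ha hn)
  have ha' : (a : ℂ) ≠ 0 := Complex.ofReal_ne_zero.2 ha.ne'
  have hw : Continuous fun x => -(Complex.I * (α / kn a n : ℝ)) * phi a α n x :=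
    continuous_const.mul (continuous_phi a α n)
  have h := inner_integralOperator hT hm hM (continuous_chiD a n) hw (fun y hy => ?_) f
  · unfold chiDL2 phiL2
    rw [h, inner_toL2_left, inner_toL2_left, ← integral_const_mul]
    refine integral_congr_ae (Eventually.of_forall fun x => ?_)
    beta_reduce
    rw [map_mul, map_neg, map_mul, Complex.conj_I, Complex.conj_ofReal]
    ring
  · set pA : ℂ := (α : ℂ) ^ 2 / 2 * a with hpA
    set qA : ℂ := -((α : ℂ) ^ 2 / (2 * a) * y) - Complex.I * α / (2 * a) with hqA
    set pB : ℂ := -(Complex.I * α / 2 * (1 - Complex.I * α * y)) with hpB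
    set qB : ℂ := -(Complex.I * α / 2 * (Complex.I * α)) with hqB
    have hcont : ∀ p q : ℂ, Continuous fun x : ℝ => (p + q * x) * chiD a n x := fun p q =>
      (by fun_prop : Continuous fun x : ℝ => p + q * (x : ℂ)).mul (continuous_chiD a n)
    have e := integral_sign_kernel (hcont pA qA) (hcont pB qB)
      (hasDerivAt_affine_mul_chiD ha hn pA qA) (hasDerivAt_affine_mul_chiD ha hn pB qB) hy
    simp only [chiD_left, chiD_right ha] at e
    refine (integral_congr_ae (Eventually.of_forall fun x => ?_)).trans (e.trans ?_)
    · rw [conj_chiD, theta3_eq, hpA, hqA, hpB, hqB]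
      field_simp
      ring
    · simp only [phi, hn, if_false, map_mul, map_neg, map_add, conj_chiD, conj_chiN,
        Complex.conj_I, Complex.conj_ofReal, hpA, hqA, hpB, hqB]
      push_cast
      field_simp
      ring_nf
      simp only [Complex.I_sq]
      ring

/-- This is `exp(iαt) - 1 = 2i exp(iαt/2) sin(αt/2)` with `t = x - y`, divided by `2a`. -/
theorem theta1_eq (ha : 0 < a) (x y : ℝ) : theta1 a α x y =
    phi a α 0 x * conj (phi a α 0 y) - chiN a 0 x * conj (chiN a 0 y) := by
  have h0 : Real.sqrt (2 * a) ≠ 0 := (Real.sqrt_pos.2 (by linarith)).ne'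
  have h1 : ((1 / Real.sqrt (2 * a) : ℝ) : ℂ) * ((1 / Real.sqrt (2 * a) : ℝ) : ℂ) =
      1 / (2 * a) := by
    rw [← Complex.ofReal_mul, div_mul_div_comm, ← sq (Real.sqrt _), Real.sq_sqrt (by linarith)]
    push_cast
    ring
  have ha' : (a : ℂ) ≠ 0 := Complex.ofReal_ne_zero.2 ha.ne'
  have h2 : Complex.exp (Complex.I * α * (x + a)) * conj (Complex.exp (Complex.I * α * (y + a))) =
      Complex.exp (Complex.I * α / 2 * (x - y)) * Complex.exp (α / 2 * (x - y) * Complex.I) := by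
    rw [← Complex.exp_conj, ← Complex.exp_add, ← Complex.exp_add]
    congr 1
    simp only [map_mul, map_add, Complex.conj_I, Complex.conj_ofReal]
    ring
  have h3 : Complex.exp (Complex.I * α / 2 * (x - y)) *
      Complex.exp (-(α / 2 * (x - y)) * Complex.I) = 1 := by
    rw [← Complex.exp_add, ← Complex.exp_zero]
    congr 1
    ring
  simp only [phi, if_true, chiN_zero, map_mul, Complex.conj_ofReal]
  unfold theta1
  rw [Complex.ofReal_sin, Complex.sin]
  push_cast at h1 ⊢
  linear_combination (-1 / (2 * a : ℂ)) * h3 - (1 / (2 * a : ℂ)) * h2 +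
    (1 - Complex.exp (Complex.I * α * (x + a)) * conj (Complex.exp (Complex.I * α * (y + a)))) * h1 +
    (Complex.exp (Complex.I * α / 2 * (x - y)) *
    (Complex.exp (-(α / 2 * (x - y)) * Complex.I) - Complex.exp (α / 2 * (x - y) * Complex.I)) /
      (2 * a)) * Complex.I_sq

theorem theta1_apply (ha : 0 < a) (hT : IsIntegralOperator a (theta1 a α) T) (f : L2 a) :
    T f = (inner ℂ (phiL2 a α 0) f : ℂ) • phiL2 a α 0 -
      (inner ℂ (chiNL2 a 0) f : ℂ) • chiNL2 a 0 := by
  have i1 : Integrable (fun y => conj (phi a α 0 y) * (f : ℝ → ℂ) y) (mu a) :=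
    Integrable.continuous_mul_mu (Complex.continuous_conj.comp (continuous_phi a α 0))
      (integrable_coeFn f)
  have i2 : Integrable (fun y => conj (chiN a 0 y) * (f : ℝ → ℂ) y) (mu a) :=
    Integrable.continuous_mul_mu (Complex.continuous_conj.comp (continuous_chiN a 0))
      (integrable_coeFn f)
  refine Lp.ext ?_
  filter_upwards [hT f,
    Lp.coeFn_sub ((inner ℂ (phiL2 a α 0) f : ℂ) • phiL2 a α 0)
      ((inner ℂ (chiNL2 a 0) f : ℂ) • chiNL2 a 0),
    Lp.coeFn_smul (inner ℂ (phiL2 a α 0) f : ℂ) (phiL2 a α 0),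
    Lp.coeFn_smul (inner ℂ (chiNL2 a 0) f : ℂ) (chiNL2 a 0),
    coeFn_toL2 a (continuous_phi a α 0), coeFn_toL2 a (continuous_chiN a 0)]
    with x h1 h2 h3 h4 h5 h6
  rw [h1.2, h2, Pi.sub_apply, h3, h4, Pi.smul_apply, Pi.smul_apply]
  unfold phiL2 chiNL2
  rw [h5, h6, inner_toL2_left, inner_toL2_left]
  simp_rw [theta1_eq ha, sub_mul, mul_assoc]
  rw [integral_sub (i1.const_mul _) (i2.const_mul _), integral_const_mul, integral_const_mul,
    smul_eq_mul, smul_eq_mul]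
  ring

theorem phiL2_eq (a α : ℝ) {n : ℕ} (hn : n ≠ 0) :
    phiL2 a α n = chiNL2 a n + (Complex.I * (α / kn a n : ℝ)) • chiDL2 a n := by
  unfold phiL2 chiNL2 chiDL2 toL2
  rw [← MemLp.toLp_const_smul, ← MemLp.toLp_add]
  refine MemLp.toLp_congr _ _ (Eventually.of_forall fun x => ?_)
  simp [phi, hn]

theorem chiDL2_zero (a : ℝ) : chiDL2 a 0 = 0 := by
  unfold chiDL2
  rw [Lp.eq_zero_iff_ae_eq_zero]
  filter_upwards [coeFn_toL2 a (continuous_chiD a 0)] with x hx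
  rw [hx, chiD_zero]; rfl

/-- For `n ≥ 1`, expand only the outer `φ_n` as `χ_n^N + i(α/k_n) χ_n^D`: the two resulting terms
are those of `J^N(1 + θ₂)` and `J^D θ₃`. At `n = 0` the term of `J^N(1 + θ₂)` is corrected by `C_0²
θ₁`. -/
theorem isStrongSum_phi (ha : 0 < a) {C : ℕ → ℝ} {JN JD θ₁ θ₂ θ₃ : L2 a →L[ℂ] L2 a}
    (hN : IsStrongSum C (chiNL2 a) JN) (hD : IsStrongSum C (chiDL2 a) JD)
    (h₁ : IsIntegralOperator a (theta1 a α) θ₁) (h₂ : IsIntegralOperator a (theta2 a α) θ₂)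
    (h₃ : IsIntegralOperator a (theta3 a α) θ₃) :
    IsStrongSum C (phiL2 a α) (JN + ((C 0 : ℂ) ^ 2) • θ₁ + JN ∘L θ₂ + JD ∘L θ₃) := by
  intro f
  have h := ((hN (f + θ₂ f)).add (hD (θ₃ f))).add_const (((C 0 : ℂ) ^ 2) • θ₁ f)
  have e : (JN + ((C 0 : ℂ) ^ 2) • θ₁ + JN ∘L θ₂ + JD ∘L θ₃) f =
      JN (f + θ₂ f) + JD (θ₃ f) + ((C 0 : ℂ) ^ 2) • θ₁ f := by
    simp only [add_apply, smul_apply,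
      ContinuousLinearMap.comp_apply, map_add]
    abel
  rw [e]
  refine h.congr' ?_
  -- The term `n = 0` has to be split off, so the partial sums are compared only for `N ≥ 1`.
  filter_upwards [eventually_ge_atTop 1] with N hN1
  obtain ⟨N, rfl⟩ := Nat.exists_eq_add_of_le' hN1
  rw [Finset.sum_range_succ', Finset.sum_range_succ', Finset.sum_range_succ', chiDL2_zero,
    smul_zero, add_zero, inner_chiN_zero_theta2 ha h₂, theta1_apply ha h₁]
  have hs : ∀ n, ((C (n + 1) : ℂ) ^ 2 * inner ℂ (phiL2 a α (n + 1)) f) • phiL2 a α (n + 1) =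
      ((C (n + 1) : ℂ) ^ 2 * inner ℂ (chiNL2 a (n + 1)) (f + θ₂ f)) • chiNL2 a (n + 1) +
      ((C (n + 1) : ℂ) ^ 2 * inner ℂ (chiDL2 a (n + 1)) (θ₃ f)) • chiDL2 a (n + 1) := by
    intro n
    rw [inner_chiN_theta2 ha h₂ n.succ_ne_zero, inner_chiD_theta3 ha h₃ n.succ_ne_zero]
    nth_rw 2 [phiL2_eq a α n.succ_ne_zero]
    rw [smul_add, smul_smul]
    congr 2
    ring
  simp_rw [hs]
  rw [Finset.sum_add_distrib, smul_sub, smul_smul, smul_smul]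
  abel

end Coefficients

/-! ### The vector orthogonal to all `φ_n` with `n ≥ 1` -/

theorem toL2_eq_zero {a : ℝ} (ha : 0 < a) {u : ℝ → ℂ} {hu : Continuous u} (h : toL2 a u hu = 0)
    {x : ℝ} (hx : x ∈ Icc (-a) a) : u x = 0 := by
  have h1 : u =ᵐ[mu a] fun _ => 0 :=
    (coeFn_toL2 a hu).symm.trans ((Lp.eq_zero_iff_ae_eq_zero).1 h)
  have h2 := (Measure.eqOn_open_of_ae_eq h1 isOpen_Ioo hu.continuousOn
    continuousOn_const).closure hu continuous_const
  rw [closure_Ioo (by linarith)] at h2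
  exact h2 hx

/-- The exponential `e^{-iα(x+a)}`, a multiple of the complex conjugate of `φ_0`. -/
def expo (a α x : ℝ) : ℂ := Complex.exp (-(Complex.I * α * (x + a)))

theorem hasDerivAt_expo (a α x : ℝ) :
    HasDerivAt (expo a α) (-(Complex.I * α) * expo a α x) x := by
  have h1 := (((hasDerivAt_ofReal x).add_const (a : ℂ)).const_mul (Complex.I * α)).neg.cexp
  convert! h1 using 1
  simp [expo]
  ring

theorem continuous_expo (a α : ℝ) : Continuous (expo a α) := by unfold expo; fun_prop

def expoL2 (a α : ℝ) : L2 a := toL2 a (expo a α) (continuous_expo a α)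

theorem expoL2_ne_zero {a : ℝ} (ha : 0 < a) (α : ℝ) : expoL2 a α ≠ 0 := fun h =>
  Complex.exp_ne_zero _ (toL2_eq_zero ha h (left_mem_Icc.2 (by linarith : -a ≤ a)))

/-- The integrand is the derivative of `χ_n^D · expo / k_n`, and `χ_n^D` vanishes at both endpoints.
-/
theorem inner_phi_expo {a : ℝ} (ha : 0 < a) (α : ℝ) {n : ℕ} (hn : n ≠ 0) :
    inner ℂ (phiL2 a α n) (expoL2 a α) = 0 := by
  have hk : (kn a n : ℂ) ≠ 0 := Complex.ofReal_ne_zero.2 (kn_ne_zero ha hn)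
  unfold phiL2 expoL2
  rw [inner_toL2_toL2 ha]
  have hd : ∀ x, HasDerivAt (fun x => chiD a n x * expo a α x / kn a n)
      (conj (phi a α n x) * expo a α x) x := by
    intro x
    convert! ((hasDerivAt_chiD a hn x).mul (hasDerivAt_expo a α x)).div_const (kn a n : ℂ) using 1
    simp only [phi, hn, if_false, map_add, map_mul, conj_chiN, conj_chiD, Complex.conj_I,
      Complex.conj_ofReal]
    push_cast
    field_simp
  rw [intervalIntegral.integral_eq_sub_of_hasDerivAt (fun x _ => hd x)
    (((Complex.continuous_conj.comp (continuous_phi a α n)).mul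
      (continuous_expo a α)).intervalIntegrable _ _)]
  simp [chiD_left, chiD_right ha]

theorem conj_phi_zero (a α x : ℝ) :
    conj (phi a α 0 x) = ((1 / Real.sqrt (2 * a) : ℝ) : ℂ) * expo a α x := by
  simp only [phi, if_true, map_mul, Complex.conj_ofReal, expo, ← Complex.exp_conj, map_add,
    Complex.conj_I, neg_mul]

/-- For `α ≠ 0` the pairing is a nonzero multiple of `exp(-4iaα) - 1`, which vanishes when `4aα` is
a multiple of `2π`. For `α = 0` the integrand is a positive constant. -/
theorem inner_phi_zero_expo {a : ℝ} (ha : 0 < a) (α : ℝ) :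
    inner ℂ (phiL2 a α 0) (expoL2 a α) = 0 ↔ ∃ n : ℕ, 1 ≤ n ∧ |α| = kn a n := by
  have hpi := Real.pi_pos
  have hs : ((1 / Real.sqrt (2 * a) : ℝ) : ℂ) ≠ 0 := by
    have h0 : Real.sqrt (2 * a) ≠ 0 := (Real.sqrt_pos.2 (by linarith)).ne'
    rw [Complex.ofReal_ne_zero]; positivity
  unfold phiL2 expoL2
  rw [inner_toL2_toL2 ha]
  simp_rw [conj_phi_zero, mul_assoc]
  rw [intervalIntegral.integral_const_mul, mul_eq_zero, or_iff_right hs]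
  rcases eq_or_ne α 0 with rfl | hα
  · constructor
    · intro h
      simp [expo] at h
      exact absurd h (by norm_cast; linarith)
    · rintro ⟨n, hn, h⟩
      rw [abs_zero] at h
      exact absurd h.symm (kn_ne_zero ha (by omega))
  · have hα' : (α : ℂ) ≠ 0 := Complex.ofReal_ne_zero.2 hα
    have ha' : (a : ℂ) ≠ 0 := Complex.ofReal_ne_zero.2 ha.ne'
    have hd : ∀ x, HasDerivAt (fun x => expo a α x * expo a α x / (-(2 * Complex.I * α)))
        (expo a α x * expo a α x) x := by
      intro x
      convert! ((hasDerivAt_expo a α x).mul (hasDerivAt_expo a α x)).div_const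
        (-(2 * Complex.I * α)) using 1
      field_simp
      ring
    rw [intervalIntegral.integral_eq_sub_of_hasDerivAt (fun x _ => hd x)
      (((continuous_expo a α).mul (continuous_expo a α)).intervalIntegrable _ _), ← sub_div,
      div_eq_zero_iff, or_iff_left (by simp [hα]), sub_eq_zero]
    have e1 : expo a α (-a) * expo a α (-a) = 1 := by simp [expo]
    have e2 : expo a α a * expo a α a = Complex.exp (-(4 * a * α : ℝ) * Complex.I) := by
      unfold expo
      rw [← Complex.exp_add]
      congr 1
      push_cast
      ring
    rw [e1, e2, Complex.exp_eq_one_iff]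
    constructor
    · rintro ⟨m, hm⟩
      have h1 : -(4 * a * α) = m * (2 * Real.pi) := by
        have := congrArg Complex.im hm
        simpa using this
      have h2 : α = -(m * Real.pi / (2 * a)) := by
        field_simp
        linarith
      have hm0 : m ≠ 0 := by
        rintro rfl
        simp at h2
        exact hα h2
      refine ⟨m.natAbs, Int.natAbs_pos.2 hm0, ?_⟩
      rw [h2, abs_neg, abs_div, abs_mul, abs_of_pos hpi, abs_of_pos (by linarith : 0 < 2 * a)]
      unfold kn
      rw [Nat.cast_natAbs, Int.cast_abs]
    · rintro ⟨n, hn, h⟩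
      have h1 : 4 * a * kn a n = n * (2 * Real.pi) := by unfold kn; field_simp; ring
      rcases abs_choice α with h' | h'
      · rw [h'] at h
        refine ⟨-n, ?_⟩
        rw [h, h1]
        push_cast
        ring
      · rw [h'] at h
        refine ⟨n, ?_⟩
        have h2 : -(4 * a * α) = n * (2 * Real.pi) := by rw [← h1, ← h]; ring
        rw [← Complex.ofReal_neg, h2]
        push_cast
        ring

/-! ### The frame bound -/

/-- The kernel of the resolvent of the Volterra operator. -/
def volterra (α x y : ℝ) : ℂ :=
  (if y < x then 1 else 0) * Complex.exp (-(Complex.I * α * (x - y)))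

theorem volterra_bounded (a α : ℝ) :
    Measurable (Function.uncurry (volterra α)) ∧
    ∀ x ∈ Ioo (-a) a, ∀ y ∈ Ioo (-a) a, ‖volterra α x y‖ ≤ 1 := by
  constructor
  · refine Measurable.mul ?_ ?_
    · exact Measurable.ite (measurableSet_lt measurable_snd measurable_fst) measurable_const
        measurable_const
    · have : Continuous fun p : ℝ × ℝ =>
          Complex.exp (-(Complex.I * α * ((p.1 : ℂ) - (p.2 : ℂ)))) := by fun_prop
      exact this.measurable
  · intro x _ y _
    unfold volterra
    rw [norm_mul, Complex.norm_exp]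
    split_ifs <;> simp

theorem theta2_apply_ae {a α : ℝ} (ha : 0 < a) {T : L2 a →L[ℂ] L2 a}
    (hT : IsIntegralOperator a (theta2 a α) T) (f : L2 a) : ∃ c : ℂ, ∀ᵐ x ∂(mu a),
      (T f : ℝ → ℂ) x = c + Complex.I * α * ∫ t in (-a)..x, (f : ℝ → ℂ) t := by
  -- Off the diagonal `sgn(y - x) = 1 - 2·1_{y<x}`: the `1` joins the part of the kernel independent
  -- of `x`, the indicator produces the primitive.
  refine ⟨∫ y, (Complex.I * α / (2 * a) * y - Complex.I * α / 2) * (f : ℝ → ℂ) y ∂(mu a), ?_⟩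
  filter_upwards [hT f, ae_mu_mem a] with x hx hxm
  rw [hx.2, ← integral_Iio_kernel (Ioo_subset_Icc_self hxm), ← integral_const_mul,
    ← integral_add]
  · refine integral_congr_ae ?_
    have hne : ∀ᵐ y ∂(mu a), y ≠ x := by
      refine ae_restrict_of_ae ?_
      simp [ae_iff, measure_singleton]
    filter_upwards [hne] with y hy
    rw [theta2_eq ha]
    rcases lt_or_gt_of_ne hy with h | h
    · rw [if_pos h, Real.sign_of_neg (by linarith)]
      push_cast
      ring
    · rw [if_neg (not_lt.2 h.le), Real.sign_of_pos (by linarith)]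
      push_cast
      ring
  · exact Integrable.continuous_mul_mu (by fun_prop) (integrable_coeFn f)
  · refine Integrable.const_mul (Integrable.bdd_mul_mu (M := 1) ?_ ?_ (integrable_coeFn f)) _
    · exact Measurable.ite measurableSet_Iio measurable_const measurable_const
    · intro y _
      split_ifs <;> simp

/-- With `F` the primitive of `f`, the hypothesis is the linear equation `F' + iαF = g - c`. The
integrating factor `exp(iα(x+a))` solves it, and `c` survives only as a multiple of `expo`. -/
theorem volterra_inversion {a α : ℝ} (ha : 0 < a) {W : L2 a →L[ℂ] L2 a}
    (hW : IsIntegralOperator a (volterra α) W) {f g : L2 a} {c : ℂ}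
    (h : ∀ᵐ x ∂(mu a), (g : ℝ → ℂ) x =
      (f : ℝ → ℂ) x + (c + Complex.I * α * ∫ t in (-a)..x, (f : ℝ → ℂ) t)) :
    f + c • expoL2 a α = g - (Complex.I * α) • W g := by
  set F : ℝ → ℂ := fun x => 0 + ∫ t in (-a)..x, (f : ℝ → ℂ) t with hF
  have hprim : IsPrimitive a F f := IsPrimitive.of_integrable (integrable_coeFn f) 0
  set e : ℝ → ℂ := fun x => Complex.exp (Complex.I * α * (x + a)) with he
  have hec : Continuous e := by simp only [he]; fun_prop
  have hed : ∀ x, HasDerivAt e (Complex.I * α * e x) x := by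
    intro x
    have h1 := (((hasDerivAt_ofReal x).add_const (a : ℂ)).const_mul (Complex.I * α)).cexp
    convert! h1 using 1
    simp only [he]
    ring
  refine Lp.ext ?_
  filter_upwards [h, hW g, ae_mu_mem a, Lp.coeFn_add f (c • expoL2 a α),
    Lp.coeFn_smul c (expoL2 a α), coeFn_toL2 a (continuous_expo a α),
    Lp.coeFn_sub g ((Complex.I * α) • W g), Lp.coeFn_smul (Complex.I * α) (W g)]
    with x h1 h2 hx h3 h4 h5 h6 h7
  rw [h3, Pi.add_apply, h4, Pi.smul_apply, h6, Pi.sub_apply, h7, Pi.smul_apply, h2.2]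
  unfold expoL2
  rw [h5, smul_eq_mul, smul_eq_mul]
  have hxI := Ioo_subset_Icc_self hx
  have hexp : expo a α x * e x = 1 := by
    simp only [expo, he]
    rw [← Complex.exp_add, neg_add_cancel, Complex.exp_zero]
  have hWg : ∫ y, volterra α x y * (g : ℝ → ℂ) y ∂(mu a) =
      expo a α x * ∫ t in (-a)..x, e t * (g : ℝ → ℂ) t := by
    rw [← integral_Iio_kernel hxI, ← integral_const_mul]
    refine integral_congr_ae (Eventually.of_forall fun y => ?_)
    have : Complex.exp (-(Complex.I * α * (x - y))) = expo a α x * e y := by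
      simp only [expo, he]
      rw [← Complex.exp_add]
      congr 1
      ring
    simp only [volterra, this]
    ring
  have hparts := hprim.integral_mul ha hed (continuous_const.mul hec) hxI
  have hFa : F (-a) = 0 := by simp [hF]
  have hFx : F x = ∫ t in (-a)..x, (f : ℝ → ℂ) t := by simp [hF]
  have hint : ∀ {v : ℝ → ℂ}, Integrable v (mu a) →
      IntervalIntegrable (fun t => e t * v t) volume (-a) x := fun hv =>
    intervalIntegrable_left (Integrable.continuous_mul_mu hec hv) hxI
  have hFi : Integrable F (mu a) := (hprim.memLp ha).integrable (by norm_num)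
  have heint : ∫ t in (-a)..x, Complex.I * α * e t = e x - 1 := by
    rw [intervalIntegral.integral_eq_sub_of_hasDerivAt (fun x _ => hed x)
      ((continuous_const.mul hec).intervalIntegrable _ _)]
    simp [he]
  have hge : ∫ t in (-a)..x, e t * (g : ℝ → ℂ) t =
      (∫ t in (-a)..x, e t * (f : ℝ → ℂ) t) + ((∫ t in (-a)..x, e t * c) +
        ∫ t in (-a)..x, Complex.I * α * e t * F t) := by
    have i1 := hint (integrable_coeFn f)
    have i2 : IntervalIntegrable (fun t => e t * c) volume (-a) x :=
      (hec.mul continuous_const).intervalIntegrable _ _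
    have i3 : IntervalIntegrable (fun t => Complex.I * α * e t * F t) volume (-a) x := by
      simpa only [mul_assoc] using ((hint hFi).const_mul α).const_mul Complex.I
    rw [← intervalIntegral.integral_add i2 i3, ← intervalIntegral.integral_add i1 (i2.add i3),
      ← integral_Iio_kernel hxI, ← integral_Iio_kernel hxI]
    refine integral_congr_ae ?_
    filter_upwards [h] with t ht
    rw [ht]
    simp only [hF]
    ring
  rw [intervalIntegral.integral_const_mul] at heint
  rw [intervalIntegral.integral_mul_const] at hge
  rw [hWg, h1, ← hFx, hge, hparts, hFa]
  linear_combination (c + Complex.I * α * F x) * hexp + c * expo a α x * heint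

/-- The lower frame bound, in the form of a transformation `f ↦ g` to the Neumann basis. -/
theorem exists_neumann_coefficients {a α : ℝ} (ha : 0 < a)
    (hα : ∀ n : ℕ, 1 ≤ n → |α| ≠ kn a n) : ∃ D : ℝ, 0 < D ∧ ∀ f : L2 a, ∃ g : L2 a,
      (∀ n, inner ℂ (chiNL2 a n) g = inner ℂ (phiL2 a α n) f) ∧ ‖f‖ ≤ D * ‖g‖ := by
  obtain ⟨hm, M, hM⟩ := theta2_bounded ha α
  obtain ⟨T, hT⟩ := exists_integralOperator hm hM
  obtain ⟨hm', hM'⟩ := volterra_bounded a α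
  obtain ⟨W, hW⟩ := exists_integralOperator hm' hM'
  set R : L2 a →L[ℂ] L2 a := ContinuousLinearMap.id ℂ (L2 a) - (Complex.I * α) • W with hR
  set d := inner ℂ (phiL2 a α 0) (expoL2 a α) with hd
  have hd0 : d ≠ 0 := fun h => by
    obtain ⟨n, hn, h'⟩ := (inner_phi_zero_expo ha α).1 h
    exact hα n hn h'
  have hd1 : 0 < ‖d‖ := norm_pos_iff.2 hd0
  -- The summands bound `R g` and `s • expoL2 a α` in `f = R g - s • expoL2 a α`; the final `1` only
  -- ensures positivity.
  refine ⟨‖R‖ + (‖phiL2 a α 0‖ * ‖R‖ + ‖chiNL2 a 0‖) / ‖d‖ * ‖expoL2 a α‖ + 1, by positivity,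
    fun f => ?_⟩
  -- Adding `b χ_0^N` corrects the coefficient at `n = 0`, the only one that `1 + θ₂` gets wrong.
  set b : ℂ := inner ℂ (phiL2 a α 0) f - inner ℂ (chiNL2 a 0) f with hb
  have horth := orthonormal_iff_ite.1 (orthonormal_chiN ha)
  have hg : ∀ n, inner ℂ (chiNL2 a n) (f + T f + b • chiNL2 a 0) = inner ℂ (phiL2 a α n) f := by
    intro n
    rw [inner_add_right, inner_smul_right, horth]
    rcases eq_or_ne n 0 with rfl | hn
    · rw [inner_chiN_zero_theta2 ha hT, if_pos rfl, hb]
      ring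
    · rw [inner_chiN_theta2 ha hT hn, if_neg hn]
      ring
  refine ⟨f + T f + b • chiNL2 a 0, hg, ?_⟩
  set g := f + T f + b • chiNL2 a 0 with hgdef
  obtain ⟨c, hc⟩ := theta2_apply_ae ha hT f
  have hinv : f + (c + b * ((1 / Real.sqrt (2 * a) : ℝ) : ℂ)) • expoL2 a α = R g := by
    refine (volterra_inversion (g := g) ha hW ?_).trans rfl
    filter_upwards [hc, Lp.coeFn_add (f + T f) (b • chiNL2 a 0), Lp.coeFn_add f (T f),
      Lp.coeFn_smul b (chiNL2 a 0), coeFn_toL2 a (continuous_chiN a 0)] with x h1 h2 h3 h4 h5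
    rw [hgdef, h2, Pi.add_apply, h3, Pi.add_apply, h4, Pi.smul_apply, h1]
    unfold chiNL2
    rw [h5, chiN_zero, smul_eq_mul]
    ring
  set s := c + b * ((1 / Real.sqrt (2 * a) : ℝ) : ℂ)
  -- Pairing the inversion formula with `φ_0` determines the unknown scalar `s`, since `d ≠ 0`.
  have hs : s * d = inner ℂ (phiL2 a α 0) (R g) - inner ℂ (chiNL2 a 0) g := by
    rw [← hinv, inner_add_right, inner_smul_right, hg]
    ring
  have hs' : ‖s‖ ≤ (‖phiL2 a α 0‖ * ‖R‖ + ‖chiNL2 a 0‖) * ‖g‖ / ‖d‖ := by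
    rw [le_div_iff₀ hd1, ← norm_mul, hs]
    refine (norm_sub_le _ _).trans ?_
    have h1 : ‖(inner ℂ (phiL2 a α 0) (R g) : ℂ)‖ ≤ ‖phiL2 a α 0‖ * (‖R‖ * ‖g‖) :=
      (norm_inner_le_norm _ _).trans (by gcongr; exact R.le_opNorm g)
    have h2 := norm_inner_le_norm (𝕜 := ℂ) (chiNL2 a 0) g
    linarith
  have hf : f = R g - s • expoL2 a α := by rw [← hinv]; abel
  calc ‖f‖ = ‖R g - s • expoL2 a α‖ := by rw [← hf]
    _ ≤ ‖R‖ * ‖g‖ + ‖s‖ * ‖expoL2 a α‖ := by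
        refine (norm_sub_le _ _).trans (add_le_add (R.le_opNorm g) (norm_smul_le _ _))
    _ ≤ ‖R‖ * ‖g‖ + (‖phiL2 a α 0‖ * ‖R‖ + ‖chiNL2 a 0‖) * ‖g‖ / ‖d‖ * ‖expoL2 a α‖ := by gcongr
    _ ≤ _ := by
        have := norm_nonneg g
        have e : (‖phiL2 a α 0‖ * ‖R‖ + ‖chiNL2 a 0‖) * ‖g‖ / ‖d‖ * ‖expoL2 a α‖ =
          (‖phiL2 a α 0‖ * ‖R‖ + ‖chiNL2 a 0‖) / ‖d‖ * ‖expoL2 a α‖ * ‖g‖ := by ring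
        rw [e]
        linarith

theorem eq_zero_of_inner_phi_eq_zero {a α : ℝ} (ha : 0 < a)
    (hα : ∀ n : ℕ, 1 ≤ n → |α| ≠ kn a n) {f : L2 a} (hf : ∀ n, inner ℂ (phiL2 a α n) f = 0) :
    f = 0 := by
  obtain ⟨D, -, hD⟩ := exists_neumann_coefficients ha hα
  obtain ⟨g, hg, hfg⟩ := hD f
  have hg0 : g = 0 := eq_zero_of_inner_chiN_eq_zero ha fun n => by rw [hg, hf]
  rw [hg0, norm_zero, mul_zero] at hfg
  exact norm_le_zero_iff.1 hfg

/-! ### Metric operators from biorthogonal systems -/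

section Abstract

variable {E : Type*} [NormedAddCommGroup E] [InnerProductSpace ℂ E]

theorem mem_graph_conjBy (S : E ≃L[ℂ] E) (T : E →ₗ.[ℂ] E) (f g : E) :
    (f, g) ∈ (conjBy S T).graph ↔ (S f, S g) ∈ T.graph := by
  simp only [LinearPMap.mem_graph_iff]
  constructor
  · rintro ⟨y, hy, h⟩
    refine ⟨⟨S y, y.2⟩, congrArg S hy, ?_⟩
    change S.symm (T ⟨S y, y.2⟩) = g at h
    rw [← h, S.apply_symm_apply]
  · rintro ⟨y, hy, h⟩
    have hf : S f ∈ T.domain := by rw [← hy]; exact y.2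
    refine ⟨⟨f, hf⟩, rfl, ?_⟩
    change S.symm (T ⟨S f, hf⟩) = g
    have : (⟨S f, hf⟩ : T.domain) = y := Subtype.ext hy.symm
    rw [this, h, S.symm_apply_apply]

variable {C : ℕ → ℝ} {φ : ℕ → E} {Θ : E →L[ℂ] E}

theorem IsStrongSum.tendsto_inner (hΘ : IsStrongSum C φ Θ) (h f : E) :
    Tendsto (fun N : ℕ => ∑ n ∈ Finset.range N,
      (C n : ℂ) ^ 2 * (inner ℂ (φ n) f * inner ℂ h (φ n))) atTop (𝓝 (inner ℂ h (Θ f))) := by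
  refine ((tendsto_const_nhds (x := h)).inner (hΘ f)).congr fun N => ?_
  rw [inner_sum]
  simp_rw [inner_smul_right, mul_assoc]

theorem IsStrongSum.inner_comm (hΘ : IsStrongSum C φ Θ) (h f : E) :
    inner ℂ (Θ h) f = inner ℂ h (Θ f) := by
  have h1 := (Complex.continuous_conj.tendsto _).comp (hΘ.tendsto_inner f h)
  rw [inner_conj_symm] at h1
  refine tendsto_nhds_unique (h1.congr fun N => ?_) (hΘ.tendsto_inner h f)
  simp only [Function.comp_apply, map_sum, map_mul, map_pow, Complex.conj_ofReal,
    inner_conj_symm]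
  exact Finset.sum_congr rfl fun n _ => by ring

theorem IsStrongSum.apply_eq_smul (hΘ : IsStrongSum C φ Θ) {f : E} {m : ℕ}
    (h : ∀ n, n ≠ m → inner ℂ (φ n) f = 0) :
    Θ f = ((C m : ℂ) ^ 2 * inner ℂ (φ m) f) • φ m := by
  refine tendsto_nhds_unique (hΘ f) (tendsto_const_nhds.congr' ?_)
  filter_upwards [eventually_gt_atTop m] with N hN
  rw [Finset.sum_eq_single m]
  · intro n _ hn
    rw [h n hn, mul_zero, zero_smul]
  · intro hm
    exact absurd (Finset.mem_range.2 hN) hm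

variable [CompleteSpace E]

/-- The diagonal operator associated with a complete biorthogonal system has the frame operator of
the dual system as a metric operator. -/
theorem isMetricOperator_of_biorthogonal {T : E →ₗ.[ℂ] E} {lam : ℕ → ℝ} {ψ : ℕ → E} {c : ℝ}
    (hΘ : IsStrongSum C φ Θ) (hC : ∀ n, C n ≠ 0) (hc : 0 < c)
    (hcoer : ∀ f, ∃ r : ℝ, inner ℂ f (Θ f) = r ∧ c * ‖f‖ ^ 2 ≤ r)
    (hT : ∀ f g, (f, g) ∈ T.graph ↔ ∀ n, inner ℂ (φ n) g = lam n * inner ℂ (φ n) f)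
    (hψ : ∀ m n, m ≠ n → inner ℂ (φ m) (ψ n) = 0) (hψ' : ∀ n, inner ℂ (φ n) (ψ n) ≠ 0) :
    IsMetricOperator T Θ := by
  have hpos : ∀ f : E, f ≠ 0 → 0 < inner ℂ f (Θ f) := by
    intro f hf
    obtain ⟨r, h1, h2⟩ := hcoer f
    have : 0 < ‖f‖ := norm_pos_iff.2 hf
    rw [h1]
    exact_mod_cast lt_of_lt_of_le (by positivity) h2
  -- Coercivity bounds `|⟨Θx, x⟩|` below, and Lax–Milgram gives invertibility.
  have hunit : IsUnit Θ := by
    refine ContinuousLinearMap.isUnit_of_forall_le_norm_inner_map Θ (c := ⟨c, hc.le⟩) hc fun x => ?_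
    obtain ⟨r, h1, h2⟩ := hcoer x
    rw [hΘ.inner_comm, h1, Complex.norm_real]
    refine le_trans ?_ (h2.trans (le_abs_self r))
    rw [mul_comm]
    rfl
  obtain ⟨U, hU⟩ := hunit
  set S : E ≃L[ℂ] E := ContinuousLinearEquiv.unitsEquiv ℂ E U with hS
  have hSΘ : (S : E →L[ℂ] E) = Θ := by rw [← hU]; rfl
  have hSf : ∀ f, S f = Θ f := fun f => by rw [← hSΘ]; rfl
  have hΘψ : ∀ n, Θ (ψ n) = ((C n : ℂ) ^ 2 * inner ℂ (φ n) (ψ n)) • φ n := fun n =>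
    hΘ.apply_eq_smul fun m hm => hψ m n hm
  have hcoef : ∀ n, (C n : ℂ) ^ 2 * inner ℂ (φ n) (ψ n) ≠ 0 := fun n =>
    mul_ne_zero (pow_ne_zero _ (Complex.ofReal_ne_zero.2 (hC n))) (hψ' n)
  have hψΘ : ∀ n f, inner ℂ (ψ n) (Θ f) =
      conj ((C n : ℂ) ^ 2 * inner ℂ (φ n) (ψ n)) * inner ℂ (φ n) f := fun n f => by
    rw [← hΘ.inner_comm, hΘψ, inner_smul_left]
  have heig : ∀ n, (ψ n, (lam n : ℂ) • ψ n) ∈ T.graph := fun n => by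
    rw [hT]
    intro m
    rw [inner_smul_right]
    rcases eq_or_ne m n with rfl | h
    · rfl
    · rw [hψ m n h, mul_zero, mul_zero]
  have hcomplete : ∀ f, (∀ n, inner ℂ (φ n) f = 0) → f = 0 := by
    intro f hf
    by_contra h0
    have hlim := hΘ.tendsto_inner f f
    simp_rw [hf, zero_mul, mul_zero, Finset.sum_const_zero] at hlim
    have := hpos f h0
    rw [tendsto_nhds_unique hlim tendsto_const_nhds] at this
    exact lt_irrefl _ this
  -- A vector `Θ f` orthogonal to the domain is orthogonal to every `ψ_n`. As `Θ ψ_n` is a nonzero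
  -- multiple of `φ_n`, all `⟨φ_n, f⟩` vanish and `f = 0`.
  have hdense : Dense (T.domain : Set E) := by
    rw [Submodule.dense_iff_topologicalClosure_eq_top, Submodule.topologicalClosure_eq_top_iff,
      Submodule.eq_bot_iff]
    intro h hh
    obtain ⟨f, rfl⟩ := S.surjective h
    have : f = 0 := hcomplete f fun n => by
      have h1 : inner ℂ (ψ n) (S f) = 0 :=
        (Submodule.mem_orthogonal _ _).1 hh _ (LinearPMap.mem_domain_of_mem_graph (heig n))
      rw [hSf, hψΘ] at h1
      exact (mul_eq_zero.1 h1).resolve_left 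
        ((map_ne_zero (starRingEnd ℂ)).2 (hcoef n))
    rw [this, map_zero]
  refine ⟨hpos, S, hSΘ, LinearPMap.eq_of_eq_graph ?_⟩
  ext ⟨f, g⟩
  rw [mem_graph_conjBy, LinearPMap.adjoint_graph_eq_graph_adjoint hdense,
    Submodule.mem_adjoint_iff]
  constructor
  · intro hfg u v huv
    rw [sub_eq_zero]
    change inner ℂ v (S f) = inner ℂ u (S g)
    rw [hSf, hSf]
    -- The series for `⟨v, Θ f⟩` and `⟨u, Θ g⟩` agree term by term because `lam n` is real.
    refine tendsto_nhds_unique ((hΘ.tendsto_inner v f).congr fun N => ?_) (hΘ.tendsto_inner u g)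
    refine Finset.sum_congr rfl fun n _ => ?_
    have h1 := (hT f g).1 hfg n
    have h2 := congrArg conj ((hT u v).1 huv n)
    rw [map_mul, inner_conj_symm, inner_conj_symm, Complex.conj_ofReal] at h2
    rw [h1, h2]
    ring
  · intro h
    rw [hT]
    intro n
    -- Testing the adjoint relation on the eigenvector `ψ_n` isolates the `n`-th coefficient.
    have h1 := h _ _ (heig n)
    change inner ℂ ((lam n : ℂ) • ψ n) (S f) - inner ℂ (ψ n) (S g) = 0 at h1
    rw [hSf, hSf, inner_smul_left, hψΘ, hψΘ, Complex.conj_ofReal] at h1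
    refine mul_left_cancel₀ ((map_ne_zero (starRingEnd ℂ)).2 (hcoef n)) ?_
    linear_combination -h1

end Abstract

/-! ### The graph of `H` in terms of the `φ_n` -/

section Graph

variable {a α : ℝ}

theorem inner_phi_of_mem_graphH (ha : 0 < a) {f g : L2 a}
    (h : (f, g) ∈ graphH a (Complex.I * α) (Complex.I * α)) (n : ℕ) :
    inner ℂ (phiL2 a α n) g = eigenvalue a α n * inner ℂ (phiL2 a α n) f := by
  obtain ⟨q, hq⟩ := exists_isEigenfunction_phi ha α n
  exact hq.inner_eq ha _ h

/-- The complex conjugate of `φ_n`, an eigenvector of `H`. -/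
def psiL2 (a α : ℝ) (n : ℕ) : L2 a :=
  toL2 a (fun x => conj (phi a α n x)) (Complex.continuous_conj.comp (continuous_phi a α n))

theorem psiL2_mem_graphH (ha : 0 < a) (n : ℕ) :
    (psiL2 a α n, (eigenvalue a α n : ℂ) • psiL2 a α n) ∈
      graphH a (Complex.I * α) (Complex.I * α) := by
  obtain ⟨q, hq⟩ := exists_isEigenfunction_phi ha α n
  exact hq.mem_graphH _

theorem psiL2_ne_zero (ha : 0 < a) (n : ℕ) : psiL2 a α n ≠ 0 := fun h => by
  have h1 := toL2_eq_zero ha h (left_mem_Icc.2 (by linarith : -a ≤ a))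
  have h3 : Real.sqrt a ≠ 0 := (Real.sqrt_pos.2 ha).ne'
  have h4 : Real.sqrt (2 * a) ≠ 0 := (Real.sqrt_pos.2 (by linarith)).ne'
  rw [map_eq_zero] at h1
  unfold phi at h1
  split_ifs at h1 with hn
  · rw [mul_eq_zero, or_iff_left (Complex.exp_ne_zero _), Complex.ofReal_eq_zero] at h1
    exact one_div_ne_zero h4 h1
  · rw [chiD_left] at h1
    simp [chiN, hn] at h1
    exact h3 (by simpa using h1)

theorem kn_injective (ha : 0 < a) : Function.Injective (kn a) := by
  intro m n h
  have hpi := Real.pi_ne_zero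
  unfold kn at h
  field_simp at h
  exact_mod_cast h

theorem kn_nonneg (ha : 0 < a) (n : ℕ) : 0 ≤ kn a n := by
  have := Real.pi_pos
  unfold kn
  positivity

/-- Only `α²` can coincide with another eigenvalue, and the condition on `α` excludes this.
Biorthogonality of `φ_m` and `ψ_n` follows. -/
theorem eigenvalue_injective (ha : 0 < a) (hα : ∀ n : ℕ, 1 ≤ n → |α| ≠ kn a n) :
    Function.Injective (eigenvalue a α) := by
  have key : ∀ n : ℕ, n ≠ 0 → α ^ 2 ≠ kn a n ^ 2 := fun n hn h => by
    refine hα n (by omega) ?_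
    rw [sq_eq_sq_iff_abs_eq_abs, abs_of_nonneg (kn_nonneg ha n)] at h
    exact h
  intro m n h
  unfold eigenvalue at h
  split_ifs at h with hm hn hn
  · rw [hm, hn]
  · exact absurd h (key n hn)
  · exact absurd h.symm (key m hm)
  · exact kn_injective ha ((sq_eq_sq₀ (kn_nonneg ha m) (kn_nonneg ha n)).1 h)

theorem inner_phi_psi_eq_zero (ha : 0 < a) (hα : ∀ n : ℕ, 1 ≤ n → |α| ≠ kn a n) {m n : ℕ}
    (hmn : m ≠ n) : inner ℂ (phiL2 a α m) (psiL2 a α n) = 0 := by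
  have h := inner_phi_of_mem_graphH ha (psiL2_mem_graphH (α := α) ha n) m
  rw [inner_smul_right] at h
  by_contra h0
  have h1 := mul_right_cancel₀ h0 h
  exact hmn (eigenvalue_injective ha hα (Complex.ofReal_injective h1)).symm

/-- Otherwise `ψ_n` would be orthogonal to all `φ_m`, contradicting their completeness. -/
theorem inner_phi_psi_ne_zero (ha : 0 < a) (hα : ∀ n : ℕ, 1 ≤ n → |α| ≠ kn a n) (n : ℕ) :
    inner ℂ (phiL2 a α n) (psiL2 a α n) ≠ 0 := fun h =>
  psiL2_ne_zero ha n <| eq_zero_of_inner_phi_eq_zero ha hα fun m => by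
    rcases eq_or_ne m n with rfl | hmn
    · exact h
    · exact inner_phi_psi_eq_zero ha hα hmn

/-- Integrate `-g` twice with constants `c₂ = v(-a)` and `c₁ = u(-a)`. Then `h₁` is the boundary
condition at `-a`, and `h₂` is the condition at `a` minus the one at `-a`. -/
theorem exists_mem_graphH (ha : 0 < a) {g : L2 a} {c₁ c₂ : ℂ}
    (h₁ : c₂ + Complex.I * α * c₁ = 0)
    (h₂ : (∫ t in (-a)..a, -(g : ℝ → ℂ) t) + Complex.I * α *
      (2 * a * c₂ + ∫ x in (-a)..a, ∫ t in (-a)..x, -(g : ℝ → ℂ) t) = 0) :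
    ∃ p, (p, g) ∈ graphH a (Complex.I * α) (Complex.I * α) := by
  set w : ℝ → ℂ := fun x => ∫ t in (-a)..x, -(g : ℝ → ℂ) t with hw
  have hwp : IsPrimitive a w fun x => -(g : ℝ → ℂ) x :=
    ⟨(integrable_coeFn g).neg, fun x _ => by simp [hw]⟩
  set v : ℝ → ℂ := fun x => c₂ + ∫ t in (-a)..x, -(g : ℝ → ℂ) t with hv
  have hvp : IsPrimitive a v fun x => -(g : ℝ → ℂ) x :=
    IsPrimitive.of_integrable (integrable_coeFn g).neg c₂
  set u : ℝ → ℂ := fun x => c₁ + ∫ t in (-a)..x, v t with hu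
  have hup : IsPrimitive a u v :=
    IsPrimitive.of_integrable ((hvp.memLp ha).integrable (by norm_num)) c₁
  have hwi : IntervalIntegrable w volume (-a) a :=
    intervalIntegrable_of_integrable ((hwp.memLp ha).integrable (by norm_num)) (by linarith)
  have hvw : ∫ t in (-a)..a, v t = 2 * a * c₂ + ∫ t in (-a)..a, w t := by
    have : ∀ t, v t = c₂ + w t := fun t => by simp [hv, hw]
    simp_rw [this]
    rw [intervalIntegral.integral_add (by simp) hwi, intervalIntegral.integral_const,
      Complex.real_smul]
    push_cast
    ring
  change w a + Complex.I * α * (2 * a * c₂ + ∫ x in (-a)..a, w x) = 0 at h₂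
  have hva : v a = c₂ + w a := by simp [hv, hw]
  have hva' : v (-a) = c₂ := by simp [hv]
  have hua' : u (-a) = c₁ := by simp [hu]
  have hua : u a = c₁ + (2 * a * c₂ + ∫ t in (-a)..a, w t) := by rw [← hvw]
  refine ⟨(hup.memLp ha).toLp u, u, v, MemLp.coeFn_toLp (hup.memLp ha), hup, hvp, ?_, ?_⟩
  · rw [hva, hua]
    linear_combination h₁ + h₂
  · rw [hva', hua', h₁]

/-- Solve the boundary value problem `H p = g` and show `p = f` by completeness. Coefficients with
`n ≥ 1` agree because their eigenvalues are nonzero; only `n = 0` needs care, when `α = 0`. -/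
theorem mem_graphH_of_inner_phi (ha : 0 < a) (hα : ∀ n : ℕ, 1 ≤ n → |α| ≠ kn a n) {f g : L2 a}
    (h : ∀ n, inner ℂ (phiL2 a α n) g = eigenvalue a α n * inner ℂ (phiL2 a α n) f) :
    (f, g) ∈ graphH a (Complex.I * α) (Complex.I * α) := by
  have hk : ∀ n, n ≠ 0 → (eigenvalue a α n : ℂ) ≠ 0 := fun n hn => by
    rw [Complex.ofReal_ne_zero]
    simp only [eigenvalue, hn, if_false]
    exact pow_ne_zero _ (kn_ne_zero ha hn)
  suffices hp : ∃ p, (p, g) ∈ graphH a (Complex.I * α) (Complex.I * α) ∧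
      inner ℂ (phiL2 a α 0) p = inner ℂ (phiL2 a α 0) f by
    obtain ⟨p, hp, hp0⟩ := hp
    have : f - p = 0 := eq_zero_of_inner_phi_eq_zero ha hα fun n => by
      rw [inner_sub_right]
      rcases eq_or_ne n 0 with rfl | hn
      · rw [hp0, sub_self]
      · rw [sub_eq_zero]
        exact mul_left_cancel₀ (hk n hn) ((h n).symm.trans (inner_phi_of_mem_graphH ha hp n))
    rwa [sub_eq_zero.1 this]
  have ha' : (a : ℂ) ≠ 0 := Complex.ofReal_ne_zero.2 ha.ne'
  rcases eq_or_ne α 0 with rfl | hα0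
  · have hg0 := h 0
    have hphi : ∀ x, conj (phi a 0 0 x) = ((1 / Real.sqrt (2 * a) : ℝ) : ℂ) := fun x => by
      rw [conj_phi_zero]; simp [expo]
    have hs : ((1 / Real.sqrt (2 * a) : ℝ) : ℂ) ≠ 0 := by
      have h0 : Real.sqrt (2 * a) ≠ 0 := (Real.sqrt_pos.2 (by linarith)).ne'
      rw [Complex.ofReal_ne_zero]; positivity
    have he : eigenvalue a 0 0 = 0 := by simp [eigenvalue]
    rw [he, Complex.ofReal_zero, zero_mul] at hg0
    unfold phiL2 at hg0
    rw [inner_toL2_left] at hg0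
    simp_rw [hphi] at hg0
    rw [integral_const_mul, integral_mu ha] at hg0
    -- For `α = 0`, the relation at `n = 0` is exactly the Neumann solvability condition `∫ g = 0`.
    have hg1 := (mul_eq_zero.1 hg0).resolve_left hs
    obtain ⟨p, hp⟩ := exists_mem_graphH (α := 0) (c₁ := 0) (c₂ := 0) (g := g) ha (by simp)
      (by simp [hg1])
    have hψ := psiL2_mem_graphH (α := 0) ha 0
    have hne := inner_phi_psi_ne_zero ha hα 0
    -- Since `ψ_0` lies in the kernel of `H`, adding a multiple of it adjusts the coefficient at `n
    -- = 0` without changing `g`.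
    refine ⟨p + ((inner ℂ (phiL2 a 0 0) f - inner ℂ (phiL2 a 0 0) p) /
      inner ℂ (phiL2 a 0 0) (psiL2 a 0 0)) • psiL2 a 0 0, ?_, ?_⟩
    · have := add_mem hp (Submodule.smul_mem _ ((inner ℂ (phiL2 a 0 0) f -
        inner ℂ (phiL2 a 0 0) p) / inner ℂ (phiL2 a 0 0) (psiL2 a 0 0)) hψ)
      rw [he, Complex.ofReal_zero, zero_smul, Prod.smul_mk, smul_zero, Prod.mk_add_mk,
        add_zero] at this
      exact this
    · rw [inner_add_right, inner_smul_right, div_mul_cancel₀ _ hne]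
      ring
  · have hα' : (α : ℂ) ≠ 0 := Complex.ofReal_ne_zero.2 hα0
    have hI := Complex.I_ne_zero
    set A := ∫ t in (-a)..a, -(g : ℝ → ℂ) t
    set B := ∫ x in (-a)..a, ∫ t in (-a)..x, -(g : ℝ → ℂ) t
    -- For `α ≠ 0` the two boundary equations form a triangular system: the second gives `c₂`, then
    -- the first gives `c₁`.
    obtain ⟨p, hp⟩ := exists_mem_graphH (α := α) (g := g)
      (c₁ := -((-A / (Complex.I * α) - B) / (2 * a)) / (Complex.I * α))
      (c₂ := (-A / (Complex.I * α) - B) / (2 * a)) ha (by field_simp; ring)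
      (by change A + Complex.I * α * (_ + B) = 0; field_simp; ring)
    refine ⟨p, hp, ?_⟩
    have h0 : (eigenvalue a α 0 : ℂ) ≠ 0 := by
      rw [Complex.ofReal_ne_zero]
      simpa [eigenvalue] using hα0
    exact mul_left_cancel₀ h0 ((inner_phi_of_mem_graphH ha hp 0).symm.trans (h 0))

end Graph

/-! ### The metric operator -/

section Metric

variable {a α m : ℝ} {C : ℕ → ℝ} {Θ : L2 a →L[ℂ] L2 a}

theorem IsStrongSum.coercive (ha : 0 < a) (hα : ∀ n : ℕ, 1 ≤ n → |α| ≠ kn a n) (hm : 0 < m)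
    (hC : ∀ n, m ≤ C n) (hΘ : IsStrongSum C (phiL2 a α) Θ) :
    ∃ c : ℝ, 0 < c ∧ ∀ f, ∃ r : ℝ, inner ℂ f (Θ f) = r ∧ c * ‖f‖ ^ 2 ≤ r := by
  obtain ⟨D, hD0, hD⟩ := exists_neumann_coefficients ha hα
  -- Indeed `⟨f, Θ f⟩ = ∑ C_n² |⟨φ_n, f⟩|² ≥ m² ‖g‖² ≥ (m²/D²) ‖f‖²`, the middle step by Parseval
  -- for `g`.
  refine ⟨m ^ 2 / D ^ 2, by positivity, fun f => ?_⟩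
  obtain ⟨g, hg, hfg⟩ := hD f
  have hlim := hΘ.tendsto_inner f f
  have hterm : ∀ n, (C n : ℂ) ^ 2 * (inner ℂ (phiL2 a α n) f * inner ℂ f (phiL2 a α n)) =
      ((C n ^ 2 * ‖(inner ℂ (phiL2 a α n) f : ℂ)‖ ^ 2 : ℝ) : ℂ) := by
    intro n
    rw [← inner_conj_symm f, Complex.mul_conj, Complex.normSq_eq_norm_sq]
    push_cast
    rfl
  simp_rw [hterm, ← Complex.ofReal_sum] at hlim
  have hre := (Complex.continuous_re.tendsto _).comp hlim
  have him := (Complex.continuous_im.tendsto _).comp hlim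
  simp only [Function.comp_def, Complex.ofReal_re, Complex.ofReal_im] at hre him
  refine ⟨(inner ℂ f (Θ f)).re, ?_, ?_⟩
  · refine Complex.ext (by simp) ?_
    rw [tendsto_nhds_unique him tendsto_const_nhds, Complex.ofReal_im]
  · have hpars := (neumannBasis ha).hasSum_inner_mul_inner g g
    have hpars' : HasSum (fun n => ‖(inner ℂ (phiL2 a α n) f : ℂ)‖ ^ 2) (‖g‖ ^ 2) := by
      rw [← Complex.hasSum_ofReal]
      convert! hpars using 1
      · ext n
        rw [coe_neumannBasis, hg, ← inner_conj_symm g, hg, mul_comm, Complex.mul_conj,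
          Complex.normSq_eq_norm_sq]
      · rw [inner_self_eq_norm_sq_to_K]
        push_cast
        rfl
    have h2 : m ^ 2 * ‖g‖ ^ 2 ≤ (inner ℂ f (Θ f)).re := by
      refine le_of_tendsto_of_tendsto' (hpars'.tendsto_sum_nat.const_mul (m ^ 2)) hre fun N => ?_
      rw [Finset.mul_sum]
      refine Finset.sum_le_sum fun n _ => ?_
      have := hC n
      gcongr
    refine le_trans ?_ h2
    rw [div_mul_eq_mul_div, div_le_iff₀ (by positivity), mul_assoc]
    gcongr
    rw [← mul_pow, mul_comm ‖g‖]
    gcongr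

theorem isMetricOperator_iff (ha : 0 < a) (hm : 0 < m) (hC : ∀ n, m ≤ C n)
    (hΘ : IsStrongSum C (phiL2 a α) Θ) :
    IsMetricOperator (opH a (Complex.I * α) (Complex.I * α)) Θ ↔
      ∀ n : ℕ, 1 ≤ n → |α| ≠ kn a n := by
  constructor
  · rintro ⟨hpos, -⟩ n hn h
    have horth : ∀ k, inner ℂ (phiL2 a α k) (expoL2 a α) = 0 := fun k => by
      rcases eq_or_ne k 0 with rfl | hk
      · exact (inner_phi_zero_expo ha α).2 ⟨n, hn, h⟩
      · exact inner_phi_expo ha α hk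
    have h1 := hpos _ (expoL2_ne_zero ha α)
    rw [hΘ.apply_eq_smul (m := 0) fun k _ => horth k, horth, mul_zero, zero_smul,
      inner_zero_right] at h1
    exact lt_irrefl _ h1
  · intro hα
    obtain ⟨c, hc, hcoer⟩ := hΘ.coercive ha hα hm hC
    refine isMetricOperator_of_biorthogonal (lam := eigenvalue a α) (ψ := psiL2 a α) hΘ
      (fun n => (hm.trans_le (hC n)).ne') hc hcoer (fun f g => ?_)
      (fun _ _ => inner_phi_psi_eq_zero ha hα) (inner_phi_psi_ne_zero ha hα)
    rw [opH_graph]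
    exact ⟨inner_phi_of_mem_graphH ha, mem_graphH_of_inner_phi ha hα⟩

end Metric

end PTRobin
end

/-! ### Assembly of the theorem -/

theorem proposition4p1 (a : ℝ) (ha : 0 < a) (α : ℝ) (C : ℕ → ℝ) (m₁ m₂ : ℝ) (hm : 0 < m₁)
    (hC : ∀ n, m₁ < C n ∧ C n < m₂) :
    ∃ Θ JN JD θ₁ θ₂ θ₃ : PTRobin.L2 a →L[ℂ] PTRobin.L2 a,
      PTRobin.IsStrongSum C (PTRobin.phiL2 a α) Θ ∧
      PTRobin.IsStrongSum C (PTRobin.chiNL2 a) JN ∧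
      PTRobin.IsStrongSum C (PTRobin.chiDL2 a) JD ∧
      PTRobin.IsIntegralOperator a (PTRobin.theta1 a α) θ₁ ∧
      PTRobin.IsIntegralOperator a (PTRobin.theta2 a α) θ₂ ∧
      PTRobin.IsIntegralOperator a (PTRobin.theta3 a α) θ₃ ∧
      Θ = JN + ((C 0 : ℂ) ^ 2) • θ₁ + JN ∘L θ₂ + JD ∘L θ₃ ∧
      (PTRobin.IsMetricOperator (PTRobin.opH a (Complex.I * α) (Complex.I * α)) Θ ↔
        ∀ n : ℕ, 1 ≤ n → |α| ≠ PTRobin.kn a n) := by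
  have hC' : ∀ n, |C n| ≤ m₂ := fun n => by
    rw [abs_of_pos (hm.trans (hC n).1)]
    exact (hC n).2.le
  obtain ⟨JN, hN⟩ := PTRobin.exists_isStrongSum hC'
    ((PTRobin.orthonormal_chiN ha).comp _ (add_left_injective 1))
  obtain ⟨JD, hD⟩ := PTRobin.exists_isStrongSum hC' (PTRobin.orthonormal_chiD ha)
  obtain ⟨m1, M1, hM1⟩ := PTRobin.theta1_bounded a α
  obtain ⟨m2, M2, hM2⟩ := PTRobin.theta2_bounded ha α
  obtain ⟨m3, M3, hM3⟩ := PTRobin.theta3_bounded a α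
  obtain ⟨θ₁, h₁⟩ := PTRobin.exists_integralOperator m1 hM1
  obtain ⟨θ₂, h₂⟩ := PTRobin.exists_integralOperator m2 hM2
  obtain ⟨θ₃, h₃⟩ := PTRobin.exists_integralOperator m3 hM3
  have hΘ := PTRobin.isStrongSum_phi ha hN hD h₁ h₂ h₃
  -- `Θ` is taken to be the right-hand side, so the formula is `rfl` and the content lies in `hΘ`.
  exact ⟨_, JN, JD, θ₁, θ₂, θ₃, hΘ, hN, hD, h₁, h₂, h₃, rfl,
    PTRobin.isMetricOperator_iff ha hm (fun n => (hC n).1.le) hΘ⟩
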